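/- **Setting.** $n$ players play a finite game repeatedly; player $i$ has a finite action set $\mathcal A_i$ with $d_i=|\mathcal A_i|\ge 2$, mixed strategies $\Delta(\mathcal A_i)$, and utility function $\mathcal U_i:\prod_j\mathcal A_j\to[-1,1]$. For a mixed profile $x$ the reward vector of player $i$ is $\nu_i(x)[\xi]=\mathbb E_{s_{-i}\sim x_{-i}}[\mathcal U_i(\xi,s_{-i})]$, and the game is $L$-smooth ($L\ge 0$): $\|\nu_i(x)-\nu_i(x')\|_\infty\le L\sum_j\|x_j-x'_j\|_1$ for all $i$ and all mixed profiles $x,x'$. In round $t=1,2,\dots$ every player $i$ plays $x_i^{t}$ and then observes $\nu_i^{t}=\nu_i(x^{t})$. The regret of a player with utilities $\nu^t$ and strategies $x^t$ is $\mathrm{Reg}^T=\max_{x^*}\sum_{t\le T}\langle\nu^t,x^*\rangle-\sum_{t\le T}\langle\nu^t,x^t\rangle$. **COFTRL** with regularizer $\psi:\Delta(\mathcal A)\to\mathbb R$ and parameters $\alpha,\eta$: with $u^0=0$, $u^{t}=\nu^{t}-\langle\nu^{t},x^{t}\rangle\mathbf 1$ and $r^{t}=\sum_{\tau<t}u^{\tau}+u^{t-1}$,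 choose $\lambda^{t}\in\arg\max_{\lambda\in(0,\eta]}\{\alpha\log\lambda+\psi^*(\lambda r^{t})\}$, where $\psi^*(g)=\max_{x\in\Delta(\mathcal A)}\{\langle g,x\rangle-\psi(x)\}$, and play $x^{t}\in\arg\max_{x\in\Delta(\mathcal A)}\{\lambda^{t}\langle r^{t},x\rangle-\psi(x)\}$. **Assumptions.** Player $i$ uses a regularizer $\psi_i$ (possibly the same for all) that is continuous on the simplex, $\mu$-strongly convex w.r.t. $\ell_1$, and $\gamma$-intrinsically Lipschitz: $|\psi_i(x')-\psi_i(x)|^2\le\gamma D_{\psi_i}(x'\|x)$ for all $x,x'$, where $D_\psi(x'\|x)=\psi(x')-\psi(x)-\langle\nabla\psi(x),x'-x\rangle$, the last term being read as the one-sided directional derivative of $\psi$ at $x$ in direction $x'-x$ where there is no gradient (so $D_\psi=+\infty$ is allowed). Let $\mathcal R=\max_i(\max\psi_i-\min\psi_i)$, $\alpha\ge4\gamma+\mu$, and $0<\eta\le\min\{\frac{3\gamma}{80},\frac{\mu}{32\sqrt2},\frac{\mu}{32\sqrt6\,Ln}\}$ (for $L=0$ the last term is $+\infty$). **Theorem.**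 There is an absolute constant $C>0$ such that the following hold. 1. *(Self-play.)* If all players run COFTRL, then for every player $i$ and all $T\ge1$ simultaneously $$\mathrm{Reg}_i^T\le 6+\frac{2(\alpha\log T+\mathcal R)}{\eta}.$$ If $\eta$ equals the minimum above, then $\mathrm{Reg}_i^T\le 6+2\,\frac{\alpha\log T+\mathcal R}{\mu}\max\{\frac{80\mu}{3\gamma},32\sqrt2,32\sqrt6\,Ln\}$ and, for every $\kappa$ with $\alpha\le\kappa(\gamma+\mu)$ (e.g. $\alpha=4\gamma+\mu$, $\kappa=4$) and all $T\ge2$, $$\mathrm{Reg}_i^T\le C\,\kappa\,\max\{1,Ln\}\,\frac{\gamma}{\mu}\,\log T .$$ In particular $\mathrm{Reg}_i^T=O(n\frac{\gamma}{\mu}\log T)$ when $\alpha=4\gamma+\mu$ and $L\le 1$. 2. *(Adversarial utilities.)* Let $\theta(T)=L^2n^2\frac{128\eta}{\mu}\bigl(3+\frac{\alpha\log T+\mathcal R}{\eta}\bigr)$. Modify COFTRL by the following switching rule: as soon as, after some round $\tau$, the observed utilities satisfy $\sum_{t=1}^{\tau-1}\|\nu^{t+1}-\nu^{t}\|_\infty^2>\theta(\tau)$,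 the player starts, from round $\tau+1$ on, a fallback online algorithm. - If all players run COFTRL with the switching rule (and arbitrary fallback algorithms), no player ever switches, so all play COFTRL and the bounds of part 1 hold. - Suppose the fallback algorithm of player $i$ guarantees regret at most $c\sqrt{T\log d_i}$ for every $T$ and every utility sequence with $\|\nu^t\|_\infty\le1$. Then COFTRL of player $i$ with the switching rule satisfies, against every such sequence and for all $T\ge1$, $$\mathrm{Reg}^T\le 8+\frac{2(\alpha\log T+\mathcal R)}{\eta}+c\sqrt{T\log d_i},$$ and there is $T_0$, not depending on the utility sequence, with $\mathrm{Reg}^T\le(c+1)\sqrt{T\log d_i}$ for all $T\ge T_0$; thus $\mathrm{Reg}^T=O(\sqrt{T\log d_i})$. - Multiplicative weights update with step size $\sqrt{\log d_i/t}$ in round $t$ is such a fallback algorithm, with $c=C$. -/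

import Mathlib

open Set Filter Topology
open scoped Matrix

noncomputable section

/-! ### Regularizers on the simplex -/

section Regularizer

variable {A : Type*} [Fintype A]

/-- The `ℓ₁` norm of a vector. (The norm `‖v‖` on `A → ℝ` is the `ℓ_∞` norm.) -/
def l1Norm (v : A → ℝ) : ℝ := ∑ a, |v a|

/-- `ψ` is `μ`-strongly convex on the simplex with respect to the `ℓ₁` norm. -/
def StronglyConvexL1 (μ : ℝ) (ψ : (A → ℝ) → ℝ) : Prop :=
  ∀ x ∈ stdSimplex ℝ A, ∀ y ∈ stdSimplex ℝ A, ∀ t ∈ Icc (0 : ℝ) 1,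
    ψ (t • x + (1 - t) • y) ≤
      t * ψ x + (1 - t) * ψ y - μ / 2 * (t * (1 - t)) * l1Norm (x - y) ^ 2

/-- One-sided directional derivative `ψ'(x; v) = lim_{t ↓ 0} (ψ (x + t v) - ψ x) / t`.
For convex `ψ` and a direction `v` pointing into the domain, the quotients are monotone in `t`,
so the limit exists in `[-∞, ∞)`; it equals `⟨∇ψ(x), v⟩` wherever `ψ` is differentiable, and it
may be `-∞` at the boundary of the simplex (as for the negative entropy). -/
def dirDeriv (ψ : (A → ℝ) → ℝ) (x v : A → ℝ) : EReal :=
  limsup (fun t : ℝ => (((ψ (x + t • v) - ψ x) / t : ℝ) : EReal)) (𝓝[>] 0)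

/-- Bregman divergence `D_ψ(x' ‖ x) = ψ(x') - ψ(x) - ⟨∇ψ(x), x' - x⟩`, with the last term read as
a one-sided directional derivative, so that it also makes sense, with value `+∞` allowed, at
boundary points of the simplex (for the negative entropy this is the Kullback-Leibler
divergence on the whole simplex). -/
def bregman (ψ : (A → ℝ) → ℝ) (x' x : A → ℝ) : EReal :=
  ((ψ x' - ψ x : ℝ) : EReal) - dirDeriv ψ x (x' - x)

/-- Where `ψ` is differentiable, `bregman` is given by the usual gradient formula. -/
theorem bregman_eq_of_hasFDerivWithinAt {ψ : (A → ℝ) → ℝ} {g : (A → ℝ) →L[ℝ] ℝ}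
    {x x' : A → ℝ} (hx : x ∈ stdSimplex ℝ A) (hx' : x' ∈ stdSimplex ℝ A)
    (hψ : HasFDerivWithinAt ψ g (stdSimplex ℝ A) x) :
    bregman ψ x' x = ((ψ x' - ψ x - g (x' - x) : ℝ) : EReal) := by
  have hline : HasDerivWithinAt (fun t : ℝ => x + t • (x' - x)) (x' - x) (Ioc 0 1) 0 := by
    have h1 : HasDerivAt (fun t : ℝ => x + t • (x' - x)) ((1 : ℝ) • (x' - x)) 0 :=
      ((hasDerivAt_id (0 : ℝ)).smul_const (x' - x)).const_add x
    rw [one_smul] at h1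
    exact h1.hasDerivWithinAt
  have hmaps : MapsTo (fun t : ℝ => x + t • (x' - x)) (Ioc 0 1) (stdSimplex ℝ A) := by
    intro t ht
    exact (convex_stdSimplex ℝ A).add_smul_sub_mem hx hx' ⟨ht.1.le, ht.2⟩
  have hψ0 : HasFDerivWithinAt ψ g (stdSimplex ℝ A) (x + (0 : ℝ) • (x' - x)) := by
    simpa using hψ
  have hc := hψ0.comp_hasDerivWithinAt (0 : ℝ) hline hmaps
  rw [hasDerivWithinAt_iff_tendsto_slope' (by simp)] at hc
  have hc' : Tendsto (fun t : ℝ => (ψ (x + t • (x' - x)) - ψ x) / t) (𝓝[>] 0)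
      (𝓝 (g (x' - x))) := by
    rw [← nhdsWithin_Ioc_eq_nhdsGT (zero_lt_one' ℝ)]
    refine hc.congr fun t => ?_
    simp [slope_def_field]
  have hl : dirDeriv ψ x (x' - x) = ((g (x' - x) : ℝ) : EReal) :=
    ((continuous_coe_real_ereal.tendsto _).comp hc').limsup_eq
  rw [bregman, hl, ← EReal.coe_sub]

/-- `ψ` is `γ`-intrinsically Lipschitz:
`|ψ(x') - ψ(x)|² ≤ γ D_ψ(x' ‖ x)` for all `x', x` in the simplex. -/
def IntrinsicallyLipschitz (γ : ℝ) (ψ : (A → ℝ) → ℝ) : Prop :=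
  ∀ x' ∈ stdSimplex ℝ A, ∀ x ∈ stdSimplex ℝ A,
    ((|ψ x' - ψ x| ^ 2 : ℝ) : EReal) ≤ (γ : EReal) * bregman ψ x' x

/-- The convex conjugate of `ψ` restricted to the simplex. -/
def simplexConjugate (ψ : (A → ℝ) → ℝ) (g : A → ℝ) : ℝ :=
  sSup ((fun x => g ⬝ᵥ x - ψ x) '' stdSimplex ℝ A)

/-- The range `max ψ - min ψ` of a regularizer on the simplex. -/
def regularizerRange (ψ : (A → ℝ) → ℝ) : ℝ :=
  sSup (ψ '' stdSimplex ℝ A) - sInf (ψ '' stdSimplex ℝ A)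

end Regularizer

/-! ### Online learning on the simplex

Rounds are numbered `0, 1, 2, …`; `ν t` is the utility vector and `x t` the strategy of
round `t`, and the first `T` rounds are the rounds `t < T`. -/

section Online

variable {A : Type*} [Fintype A]

/-- External regret over the first `T` rounds. -/
def regret (ν x : ℕ → A → ℝ) (T : ℕ) : ℝ :=
  sSup ((fun z => ∑ t ∈ Finset.range T, ν t ⬝ᵥ z) '' stdSimplex ℝ A)
    - ∑ t ∈ Finset.range T, ν t ⬝ᵥ x t

/-- The corrected reward signal `u = ν - ⟨ν, x⟩ 𝟏`. -/
def correctedReward (ν x : ℕ → A → ℝ) (t : ℕ) : A → ℝ :=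
  fun a => ν t a - ν t ⬝ᵥ x t

/-- The optimistic cumulated regret vector used in round `t`: the sum of all corrected reward
signals of earlier rounds, plus once more the most recent one (zero in the first round). -/
def optimisticRegret (ν x : ℕ → A → ℝ) (t : ℕ) : A → ℝ :=
  ∑ τ ∈ Finset.range t, correctedReward ν x τ
    + (if t = 0 then 0 else correctedReward ν x (t - 1))

/-- One step of COFTRL: `z` is the OFTRL strategy for the regret vector `r` with the learning rate
`l` that solves the learning rate control problem on `(0, η]`. -/
def IsCOFTRLStep (ψ : (A → ℝ) → ℝ) (α η : ℝ) (r z : A → ℝ) : Prop :=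
  ∃ l ∈ Ioc 0 η,
    IsMaxOn (fun l' : ℝ => α * Real.log l' + simplexConjugate ψ (l' • r)) (Ioc 0 η) l ∧
    z ∈ stdSimplex ℝ A ∧ IsMaxOn (fun w => l * (r ⬝ᵥ w) - ψ w) (stdSimplex ℝ A) z

/-- The strategies `x` are those of COFTRL when it observes the utilities `ν`. -/
def IsCOFTRL (ψ : (A → ℝ) → ℝ) (α η : ℝ) (ν x : ℕ → A → ℝ) : Prop :=
  ∀ t, IsCOFTRLStep ψ α η (optimisticRegret ν x t) (x t)

/-- Total squared variation of the first `T` utility vectors. -/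
def utilityVariation (ν : ℕ → A → ℝ) (T : ℕ) : ℝ :=
  ∑ t ∈ Finset.range (T - 1), ‖ν (t + 1) - ν t‖ ^ 2

variable (A) in
/-- A (deterministic, full-information) online learning algorithm: it maps the `t` utility vectors
observed so far to the strategy of the next round. -/
def OnlineAlgorithm : Type _ := (t : ℕ) → (Fin t → A → ℝ) → stdSimplex ℝ A

/-- The strategies of an online algorithm when it observes the utilities `ν`. -/
def OnlineAlgorithm.play (B : OnlineAlgorithm A) (ν : ℕ → A → ℝ) (t : ℕ) : A → ℝ :=
  (B t fun k => ν k : stdSimplex ℝ A)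

/-- `B` has regret at most `c √(T log d)` for all `T` and all utilities bounded by one. -/
def OnlineAlgorithm.HasRegretBound (B : OnlineAlgorithm A) (c : ℝ) : Prop :=
  ∀ ν : ℕ → A → ℝ, (∀ t, ‖ν t‖ ≤ 1) →
    ∀ T : ℕ, regret ν (B.play ν) T ≤ c * Real.sqrt (T * Real.log (Fintype.card A))

variable (A) in
/-- Multiplicative weights update with the step size `√(log d / t)` in the `t`-th round
(which is the round after `t - 1` observations). -/
def mwu [Nonempty A] : OnlineAlgorithm A := fun t h =>
  let w : A → ℝ := fun a =>
    Real.exp (Real.sqrt (Real.log (Fintype.card A) / (t + 1)) * ∑ k, h k a)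
  ⟨fun a => w a / ∑ b, w b, by
    have hpos : 0 < ∑ b, w b :=
      Finset.sum_pos (fun b _ => Real.exp_pos _) Finset.univ_nonempty
    refine ⟨fun a => div_nonneg (Real.exp_pos _).le hpos.le, ?_⟩
    rw [← Finset.sum_div, div_self hpos.ne']⟩

/-- COFTRL with a switching rule: as long as the utility variation observed so far has never
exceeded the threshold `θ`, play COFTRL; from the first time `τ` at which it does, start the
fallback algorithm `B` afresh on the utilities of the rounds `τ, τ + 1, …`. -/
def IsSwitchingCOFTRL (ψ : (A → ℝ) → ℝ) (α η : ℝ) (θ : ℕ → ℝ) (B : OnlineAlgorithm A)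
    (ν x : ℕ → A → ℝ) : Prop :=
  ∀ t,
    ((∀ τ ≤ t, utilityVariation ν τ ≤ θ τ) →
      IsCOFTRLStep ψ α η (optimisticRegret ν x t) (x t)) ∧
    (∀ τ ≤ t, θ τ < utilityVariation ν τ → (∀ σ < τ, utilityVariation ν σ ≤ θ σ) →
      x t = B.play (fun k => ν (τ + k)) (t - τ))

end Online

/-! ### Finite games -/

section Game

variable {n : ℕ} {A : Fin n → Type*} [∀ i, Fintype (A i)]

/-- Expected value of `u` when the players draw their actions independently from `x`. -/
def expectedUtility (u : (∀ j, A j) → ℝ) (x : ∀ j, A j → ℝ) : ℝ :=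
  ∑ s : (∀ j, A j), (∏ j, x j (s j)) * u s

open Classical in
/-- The reward vector of player `i`: its entry at `ξ` is the expected utility of player `i` when
she plays the pure action `ξ` and the others play according to `x`. -/
def utilityGradient (U : Fin n → (∀ j, A j) → ℝ) (i : Fin n) (x : ∀ j, A j → ℝ) : A i → ℝ :=
  fun ξ => expectedUtility (U i) (Function.update x i (Pi.single ξ 1))

/-- Utilities are bounded by one. -/
def BoundedUtilities (U : Fin n → (∀ j, A j) → ℝ) : Prop := ∀ i s, |U i s| ≤ 1

/-- Utilities are `L`-smooth. -/
def SmoothUtilities (L : ℝ) (U : Fin n → (∀ j, A j) → ℝ) : Prop :=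
  ∀ i, ∀ x x' : ∀ j, A j → ℝ, (∀ j, x j ∈ stdSimplex ℝ (A j)) →
    (∀ j, x' j ∈ stdSimplex ℝ (A j)) →
    ‖utilityGradient U i x - utilityGradient U i x'‖ ≤ L * ∑ j, l1Norm (x j - x' j)

/-- The utility vectors that player `i` observes when the players play `x t` in round `t`. -/
def observedUtility (U : Fin n → (∀ j, A j) → ℝ) (x : ∀ j, ℕ → A j → ℝ) (i : Fin n) :
    ℕ → A i → ℝ :=
  fun t => utilityGradient U i (fun j => x j t)

/-- The largest range `max ψ_i - min ψ_i` of the players' regularizers. -/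
def maxRange (ψ : ∀ i, (A i → ℝ) → ℝ) : ℝ := ⨆ i, regularizerRange (ψ i)

/-- The threshold of the switching rule after `T` rounds. -/
def switchThreshold (n : ℕ) (L μ α η R : ℝ) (T : ℕ) : ℝ :=
  L ^ 2 * n ^ 2 * (128 * η / μ) * (3 + (α * Real.log T + R) / η)

end Game

end

noncomputable section

/-! ### Regularizers on the simplex, and the scalar inequalities behind one step of COFTRL -/

section Regularizer

variable {A : Type*} [Fintype A]

/-! Rate and strategy of a COFTRL round jointly maximize `α log l + l ⟨r, w⟩ - ψ w` over `(0, η]`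
times the simplex, so the algorithm is optimistic FTRL in the lifted variable `(l, w)`. Changing the
rate by a factor `ρ` creates a cross term `(1 - ρ)(ψ x' - ψ x)`. Intrinsic Lipschitzness bounds the
square of the regularizer gap by `γ` times a divergence, so with `α ≥ 4γ + μ` the logarithm absorbs
the cross term (`gap_step_bound`). Telescoping (`IsCOFTRLOptimum.objective_add_le`) gives
`IsCOFTRLStep.rvu`: for every rate `l`, `l` times the regret against `w` is at most `α log (η / l)`
plus the range plus utility variation, minus strategy movement.

This inequality is used at two rates. At `l = η / T` its left side is at least `-2η`, however
negative the regret, at the price of `α log T`. Summed over the players, with smoothness turning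
utility variation into movement, it bounds the total movement by `O(log T)`
(`sum_strategyVariation_le`), so the utility variation stays below the switching threshold. At `l =
η` the logarithm disappears, and the threshold bound on the variation gives the regret bound.

The second use needs only the threshold bound, not self-play. Against an adversary it therefore
covers all rounds up to the crossing, except for one round of cost at most 2; the fallback algorithm
pays for the rest. For multiplicative weights, a normalized log-sum-exp potential is monotone in the
step size, which handles decreasing steps. -/

theorem nonempty_stdSimplex [Nonempty A] : (stdSimplex ℝ A).Nonempty :=
  Set.nonempty_coe_sort.1 inferInstance

theorem l1Norm_nonneg (v : A → ℝ) : 0 ≤ l1Norm v :=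
  Finset.sum_nonneg fun _ _ => abs_nonneg _

theorem abs_dotProduct_le (v w : A → ℝ) : |v ⬝ᵥ w| ≤ ‖v‖ * l1Norm w := by
  rw [dotProduct, l1Norm, Finset.mul_sum]
  refine (Finset.abs_sum_le_sum_abs _ _).trans (Finset.sum_le_sum fun a _ => ?_)
  rw [abs_mul]
  exact mul_le_mul_of_nonneg_right (norm_le_pi_norm v a) (abs_nonneg _)

theorem l1Norm_of_mem_stdSimplex {x : A → ℝ} (hx : x ∈ stdSimplex ℝ A) : l1Norm x = 1 := by
  rw [← hx.2]
  exact Finset.sum_congr rfl fun a _ => abs_of_nonneg (hx.1 a)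

theorem abs_dotProduct_le_norm (v : A → ℝ) {x : A → ℝ} (hx : x ∈ stdSimplex ℝ A) :
    |v ⬝ᵥ x| ≤ ‖v‖ := by
  simpa [l1Norm_of_mem_stdSimplex hx] using abs_dotProduct_le v x

theorem l1Norm_sub_le (v w : A → ℝ) : l1Norm (v - w) ≤ l1Norm v + l1Norm w := by
  rw [l1Norm, l1Norm, l1Norm, ← Finset.sum_add_distrib]
  exact Finset.sum_le_sum fun a _ => abs_sub _ _

theorem l1Norm_sub_le_two {x y : A → ℝ} (hx : x ∈ stdSimplex ℝ A) (hy : y ∈ stdSimplex ℝ A) :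
    l1Norm (x - y) ≤ 2 := by
  have := l1Norm_sub_le x y
  rw [l1Norm_of_mem_stdSimplex hx, l1Norm_of_mem_stdSimplex hy] at this
  linarith

/-- Some vertex of the simplex has `ℓ₁` distance at least one from a given point. -/
theorem exists_one_le_l1Norm_sub [Nontrivial A] {x : A → ℝ} (hx : x ∈ stdSimplex ℝ A) :
    ∃ y ∈ stdSimplex ℝ A, 1 ≤ l1Norm (y - x) := by
  classical
  obtain ⟨a, b, hab⟩ := exists_pair_ne A
  have key : ∀ c : A, 2 * (1 - x c) ≤ l1Norm (Pi.single c 1 - x) := by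
    intro c
    have h1 : ∑ e ∈ Finset.univ.erase c, x e = 1 - x c := by
      rw [← hx.2, ← Finset.add_sum_erase _ _ (Finset.mem_univ c)]
      ring
    rw [l1Norm, ← Finset.add_sum_erase _ _ (Finset.mem_univ c)]
    have h2 : ∑ e ∈ Finset.univ.erase c, |(Pi.single c 1 - x : A → ℝ) e| = 1 - x c := by
      rw [← h1]
      refine Finset.sum_congr rfl fun e he => ?_
      have : e ≠ c := Finset.ne_of_mem_erase he
      simp [Pi.single_eq_of_ne this, abs_of_nonneg (hx.1 e)]
    rw [h2]
    have := le_abs_self ((Pi.single c 1 - x : A → ℝ) c)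
    simp only [Pi.sub_apply, Pi.single_eq_same] at this ⊢
    linarith
  have hsum : x a + x b ≤ 1 := by
    rw [← hx.2, ← Finset.sum_pair hab]
    exact Finset.sum_le_sum_of_subset_of_nonneg (Finset.subset_univ _) fun e _ _ => hx.1 e
  rcases le_total (x a) (1 / 2) with h | h
  · exact ⟨Pi.single a 1, single_mem_stdSimplex ℝ a, by linarith [key a]⟩
  · exact ⟨Pi.single b 1, single_mem_stdSimplex ℝ b, by linarith [key b]⟩

variable {ψ : (A → ℝ) → ℝ} {g x x' : A → ℝ} {γ μ : ℝ}

theorem IsMaxOn.add_smul_sub_le (hx : x ∈ stdSimplex ℝ A) (hx' : x' ∈ stdSimplex ℝ A)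
    (hmax : IsMaxOn (fun w => g ⬝ᵥ w - ψ w) (stdSimplex ℝ A) x) {t : ℝ} (ht : t ∈ Icc (0 : ℝ) 1) :
    t * (g ⬝ᵥ (x' - x)) ≤ ψ (x + t • (x' - x)) - ψ x := by
  have h : g ⬝ᵥ (x + t • (x' - x)) - ψ (x + t • (x' - x)) ≤ g ⬝ᵥ x - ψ x :=
    hmax ((convex_stdSimplex ℝ A).add_smul_sub_mem hx hx' ht)
  rw [dotProduct_add, dotProduct_smul, smul_eq_mul] at h
  linarith

/-- At a point where a linear perturbation of `ψ` is optimal, the Bregman divergence is at most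
the suboptimality of the other point. -/
theorem bregman_le_of_isMaxOn (hx : x ∈ stdSimplex ℝ A) (hx' : x' ∈ stdSimplex ℝ A)
    (hmax : IsMaxOn (fun w => g ⬝ᵥ w - ψ w) (stdSimplex ℝ A) x) :
    bregman ψ x' x ≤ ((ψ x' - ψ x - g ⬝ᵥ (x' - x) : ℝ) : EReal) := by
  have h : ((g ⬝ᵥ (x' - x) : ℝ) : EReal) ≤ dirDeriv ψ x (x' - x) := by
    refine le_limsup_of_frequently_le (Eventually.frequently ?_)
    have : ∀ᶠ t : ℝ in 𝓝[>] 0, t ∈ Ioc (0 : ℝ) 1 := Ioc_mem_nhdsGT zero_lt_one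
    filter_upwards [this] with t ht
    rw [EReal.coe_le_coe_iff, le_div_iff₀ ht.1]
    linarith [hmax.add_smul_sub_le hx hx' ⟨ht.1.le, ht.2⟩]
  rw [bregman, EReal.coe_sub (ψ x' - ψ x)]
  exact EReal.sub_le_sub le_rfl h

/-- Optimality of `x` replaces the extended-real divergence by a real gap, so no differentiability
of `ψ` is needed from here on. -/
theorem IntrinsicallyLipschitz.sq_le_of_isMaxOn (hψ : IntrinsicallyLipschitz γ ψ) (hγ : 0 ≤ γ)
    (hx : x ∈ stdSimplex ℝ A) (hx' : x' ∈ stdSimplex ℝ A)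
    (hmax : IsMaxOn (fun w => g ⬝ᵥ w - ψ w) (stdSimplex ℝ A) x) :
    (ψ x' - ψ x) ^ 2 ≤ γ * (ψ x' - ψ x - g ⬝ᵥ (x' - x)) := by
  have h := (hψ x' hx' x hx).trans
    (mul_le_mul_of_nonneg_left (bregman_le_of_isMaxOn hx hx' hmax) (EReal.coe_nonneg.2 hγ))
  rw [← EReal.coe_mul, EReal.coe_le_coe_iff, sq_abs] at h
  exact h

theorem StronglyConvexL1.sq_le_of_isMaxOn (hψ : StronglyConvexL1 μ ψ)
    (hx : x ∈ stdSimplex ℝ A) (hx' : x' ∈ stdSimplex ℝ A)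
    (hmax : IsMaxOn (fun w => g ⬝ᵥ w - ψ w) (stdSimplex ℝ A) x) :
    μ / 2 * l1Norm (x' - x) ^ 2 ≤ ψ x' - ψ x - g ⬝ᵥ (x' - x) := by
  have hlim : Tendsto (fun t : ℝ => μ / 2 * (1 - t) * l1Norm (x' - x) ^ 2) (𝓝[>] 0)
      (𝓝 (μ / 2 * (1 - 0) * l1Norm (x' - x) ^ 2)) :=
    (Continuous.tendsto (by fun_prop) 0).mono_left nhdsWithin_le_nhds
  rw [sub_zero, mul_one] at hlim
  refine le_of_tendsto hlim ?_
  -- Compare strong convexity on the segment from `x` to `x'` with optimality of `x`, divide by `t`,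
  -- and let `t ↓ 0`.
  filter_upwards [Ioc_mem_nhdsGT (zero_lt_one' ℝ)] with t ht
  have h1 := hmax.add_smul_sub_le hx hx' ⟨ht.1.le, ht.2⟩
  have h2 := hψ x' hx' x hx t ⟨ht.1.le, ht.2⟩
  have h3 : t • x' + (1 - t) • x = x + t • (x' - x) := by
    rw [smul_sub, sub_smul, one_smul]; abel
  rw [h3] at h2
  refine le_of_mul_le_mul_left ?_ ht.1
  linarith

/-- A regularizer meeting the assumptions of COFTRL, together with its parameters. -/
structure IsCOFTRLRegularizer (ψ : (A → ℝ) → ℝ) (γ μ α η : ℝ) : Prop where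
  continuousOn : ContinuousOn ψ (stdSimplex ℝ A)
  lipschitz : IntrinsicallyLipschitz γ ψ
  convex : StronglyConvexL1 μ ψ
  le_alpha : 4 * γ + μ ≤ α
  eta_pos : 0 < η
  eta_le_gamma : η ≤ 3 * γ / 80
  eta_le_mu : η ≤ μ / (32 * Real.sqrt 2)

namespace IsCOFTRLRegularizer

variable {α η : ℝ}

theorem gamma_pos (h : IsCOFTRLRegularizer ψ γ μ α η) : 0 < γ := by
  linarith [h.eta_pos, h.eta_le_gamma]

theorem mu_pos (h : IsCOFTRLRegularizer ψ γ μ α η) : 0 < μ := by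
  have h1 := h.eta_pos.trans_le h.eta_le_mu
  have h2 : 0 < 32 * Real.sqrt 2 := by positivity
  simpa using (lt_div_iff₀ h2).1 h1

theorem alpha_pos (h : IsCOFTRLRegularizer ψ γ μ α η) : 0 < α := by
  linarith [h.gamma_pos, h.mu_pos, h.le_alpha]

theorem mul_eta_le_mu (h : IsCOFTRLRegularizer ψ γ μ α η) : 45 * η ≤ μ := by
  have h2 : (0 : ℝ) < 32 * Real.sqrt 2 := by positivity
  have h1 := (le_div_iff₀ h2).1 h.eta_le_mu
  have h3 : (1.41 : ℝ) ≤ Real.sqrt 2 := Real.le_sqrt_of_sq_le (by norm_num)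
  nlinarith [h.eta_pos]

/-- At a minimizer `m` the zero functional is optimal, so `(ψ x' - ψ m)² ≤ γ (ψ x' - ψ m)`. Hence
intrinsic Lipschitzness alone bounds the range. -/
theorem sub_le_gamma (h : IsCOFTRLRegularizer ψ γ μ α η) (hx : x ∈ stdSimplex ℝ A)
    (hx' : x' ∈ stdSimplex ℝ A) : ψ x' - ψ x ≤ γ := by
  obtain ⟨m, hm, hmin⟩ := (isCompact_stdSimplex ℝ A).exists_isMinOn ⟨x, hx⟩ h.continuousOn
  have hmax : IsMaxOn (fun w => (0 : A → ℝ) ⬝ᵥ w - ψ w) (stdSimplex ℝ A) m := by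
    intro w hw
    simpa using hmin hw
  have h1 := h.lipschitz.sq_le_of_isMaxOn h.gamma_pos.le hm hx' hmax
  rw [zero_dotProduct, sub_zero] at h1
  have h2 : ψ m ≤ ψ x := hmin hx
  have h3 : ψ m ≤ ψ x' := hmin hx'
  by_contra hcon
  nlinarith [h.gamma_pos]

theorem regularizerRange_le [Nonempty A] (h : IsCOFTRLRegularizer ψ γ μ α η) :
    regularizerRange ψ ≤ γ := by
  have hne : (ψ '' stdSimplex ℝ A).Nonempty := (nonempty_stdSimplex (A := A)).image _
  have h1 : sSup (ψ '' stdSimplex ℝ A) ≤ sInf (ψ '' stdSimplex ℝ A) + γ := by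
    refine csSup_le hne ?_
    rintro _ ⟨x', hx', rfl⟩
    rw [← sub_le_iff_le_add]
    refine le_csInf hne ?_
    rintro _ ⟨x, hx, rfl⟩
    linarith [h.sub_le_gamma hx hx']
  rw [regularizerRange]
  linarith

theorem sub_le_regularizerRange (h : IsCOFTRLRegularizer ψ γ μ α η)
    (hx : x ∈ stdSimplex ℝ A) (hx' : x' ∈ stdSimplex ℝ A) :
    ψ x' - ψ x ≤ regularizerRange ψ := by
  have hc := (isCompact_stdSimplex ℝ A).image_of_continuousOn h.continuousOn
  exact sub_le_sub (le_csSup hc.bddAbove ⟨x', hx', rfl⟩) (csInf_le hc.bddBelow ⟨x, hx, rfl⟩)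

/-- Strong convexity at the minimizer makes `ψ` rise by `μ / 2` at distance one, while its range is
at most `γ`. This keeps `γ / μ` away from zero in the final rate. -/
theorem mu_le_gamma [Nontrivial A] (h : IsCOFTRLRegularizer ψ γ μ α η) : μ ≤ 2 * γ := by
  obtain ⟨m, hm, hmin⟩ := (isCompact_stdSimplex ℝ A).exists_isMinOn nonempty_stdSimplex
    h.continuousOn
  have hmax : IsMaxOn (fun w => (0 : A → ℝ) ⬝ᵥ w - ψ w) (stdSimplex ℝ A) m := by
    intro w hw
    simpa using hmin hw
  obtain ⟨y, hy, hd⟩ := exists_one_le_l1Norm_sub hm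
  have h1 := h.convex.sq_le_of_isMaxOn hm hy hmax
  have h2 := h.sub_le_gamma hm hy
  rw [zero_dotProduct, sub_zero] at h1
  have h3 : 1 ≤ l1Norm (y - m) ^ 2 := one_le_pow₀ hd
  nlinarith [h.mu_pos]

end IsCOFTRLRegularizer

theorem half_sq_div_le_sub_log {ρ : ℝ} (hρ : 1 / 2 ≤ ρ) :
    (1 - ρ) ^ 2 / (4 * ρ) ≤ ρ - 1 - Real.log ρ := by
  have hpos : 0 < ρ := by linarith
  rcases le_total 1 ρ with h1 | h1
  · have h2 : Real.log ρ = 2 * Real.log (Real.sqrt ρ) := by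
      rw [Real.log_sqrt hpos.le]; ring
    have hs : 0 < Real.sqrt ρ := Real.sqrt_pos.2 hpos
    have hs1 : 1 ≤ Real.sqrt ρ := Real.one_le_sqrt.2 h1
    have hsq : Real.sqrt ρ ^ 2 = ρ := Real.sq_sqrt hpos.le
    have h3 := Real.log_le_sub_one_of_pos hs
    rw [h2, div_le_iff₀ (by positivity)]
    set s := Real.sqrt ρ
    -- With `ρ = s²`, the bound `log s ≤ s - 1` leaves exactly `s² - 1 - 2(s - 1) = (s - 1)²`.
    have h4 : (s - 1) ^ 2 ≤ ρ - 1 - 2 * Real.log s := by nlinarith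
    have h5 : (1 - ρ) ^ 2 = (s - 1) ^ 2 * (s + 1) ^ 2 := by rw [← hsq]; ring
    rw [h5]
    have h6 : (s + 1) ^ 2 ≤ 4 * ρ := by nlinarith
    nlinarith [mul_le_mul_of_nonneg_left h6 (sq_nonneg (s - 1)),
      mul_le_mul_of_nonneg_right h4 (by positivity : (0 : ℝ) ≤ 4 * ρ)]
  · have h2 : (0 : ℝ) ≤ ρ⁻¹ - 1 := by linarith [(one_le_inv₀ hpos).2 h1]
    have h3 := Real.le_log_one_add_of_nonneg h2
    rw [add_sub_cancel, Real.log_inv] at h3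
    have h4 : 2 * (ρ⁻¹ - 1) / (ρ⁻¹ - 1 + 2) = (1 - ρ) ^ 2 / (1 + ρ) - (ρ - 1) := by
      field_simp
      ring
    have h5 : (1 - ρ) ^ 2 / (4 * ρ) ≤ (1 - ρ) ^ 2 / (1 + ρ) :=
      div_le_div_of_nonneg_left (sq_nonneg _) (by linarith) (by linarith)
    linarith

/-- The tangent line at `ρ = 1/2` of the convex right-hand side. -/
theorem log_two_sub_le_sub_log {ρ : ℝ} (hρ : 0 < ρ) :
    Real.log 2 - ρ ≤ ρ - 1 - Real.log ρ := by
  have h := Real.log_le_sub_one_of_pos (x := 2 * ρ) (by linarith)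
  rw [Real.log_mul two_ne_zero hρ.ne'] at h
  linarith

/-- Here `ρ` is the ratio of consecutive rates, `δ` the change of `ψ`, `D` the divergence surrogate,
`V` the prediction error, `d` the movement and `B` the error term linear in `V`. For `ρ ≥ 1/2`, the
part `4γ` of `α` and half of `ρ D` pay for the cross term, and the rest pays for `B`. For `ρ < 1/2`,
the logarithm exceeds a constant that dominates all bounded terms. -/
theorem gap_step_bound {α γ μ η ρ l δ D V d B : ℝ} (hγ : 0 < γ) (hμ : 0 < μ)
    (hα : 4 * γ + μ ≤ α) (hη : η ≤ 3 * γ / 80) (hρ : 0 < ρ) (hl : 0 < l) (hlη : l ≤ η)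
    (hρl : ρ * l ≤ η) (hV : 0 ≤ V) (hV4 : V ≤ 4) (hd : 0 ≤ d) (hd2 : d ≤ 2)
    (hδD : δ ^ 2 ≤ γ * D) (hδ : |δ| ≤ γ) (hD : μ / 2 * d ^ 2 ≤ D)
    (hB : B ≤ V * (l * |1 - ρ| + l * d)) (hB' : B ≤ V * (l + ρ * l)) :
    B - (α * (ρ - 1 - Real.log ρ) + (1 - ρ) * δ + ρ * D) ≤
      5 * η ^ 2 / μ * V ^ 2 - μ / 32 * d ^ 2 := by
  have hη0 : 0 < η := hl.trans_le hlη
  have hlog : 0 ≤ ρ - 1 - Real.log ρ := by linarith [Real.log_le_sub_one_of_pos hρ]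
  have hαlog := mul_le_mul_of_nonneg_right hα hlog
  rcases le_total (1 / 2) ρ with h | h
  · have h1 := half_sq_div_le_sub_log h
    have h2 := mul_le_mul_of_nonneg_left h1 (by positivity : 0 ≤ 4 * γ + μ)
    have h3 : -(ρ * D / 2 + γ * ((1 - ρ) ^ 2 / (2 * ρ))) ≤ (1 - ρ) * δ := by
      -- Completing the square in `δ`; `δ² ≤ γ D` then converts the quadratic term into `ρ D / 2`.
      have h4 : 0 ≤ ((1 - ρ) * γ + ρ * δ) ^ 2 / (2 * ρ * γ) := by positivity
      have h5 : ((1 - ρ) * γ + ρ * δ) ^ 2 / (2 * ρ * γ) =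
          γ * ((1 - ρ) ^ 2 / (2 * ρ)) + (1 - ρ) * δ + ρ * (δ ^ 2 / γ) / 2 := by
        field_simp
        ring
      have h6 : δ ^ 2 / γ ≤ D := by rwa [div_le_iff₀' hγ]
      have h7 := mul_le_mul_of_nonneg_left h6 hρ.le
      linarith
    -- Young's inequality for the change of the learning rate
    have h8 : V * (l * |1 - ρ|) ≤ μ * ((1 - ρ) ^ 2 / (4 * ρ)) + η ^ 2 / μ * V ^ 2 := by
      have h9 : ρ * l ^ 2 ≤ η ^ 2 := by nlinarith
      have h10 : 0 ≤ (μ * |1 - ρ| - 2 * ρ * l * V) ^ 2 / (4 * ρ * μ) := by positivity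
      have h11 : (μ * |1 - ρ| - 2 * ρ * l * V) ^ 2 / (4 * ρ * μ) =
          μ * (|1 - ρ| ^ 2 / (4 * ρ)) - V * (l * |1 - ρ|) + ρ * l ^ 2 / μ * V ^ 2 := by
        field_simp
        ring
      have h12 : ρ * l ^ 2 / μ * V ^ 2 ≤ η ^ 2 / μ * V ^ 2 := by gcongr
      rw [sq_abs] at h11
      linarith
    -- Young's inequality for the change of the strategy
    have h13 : V * (l * d) ≤ μ / 16 * d ^ 2 + 4 * η ^ 2 / μ * V ^ 2 := by
      have h14 : 0 ≤ (μ * d - 8 * η * V) ^ 2 / (16 * μ) := by positivity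
      have h15 : (μ * d - 8 * η * V) ^ 2 / (16 * μ) =
          μ / 16 * d ^ 2 - V * (η * d) + 4 * η ^ 2 / μ * V ^ 2 := by
        field_simp
        ring
      have h16 : V * (l * d) ≤ V * (η * d) := by gcongr
      linarith
    have h17 : μ / 8 * d ^ 2 ≤ ρ * D / 2 := by nlinarith [mul_nonneg hμ.le (sq_nonneg d)]
    have h18 : 0 ≤ γ * ((1 - ρ) ^ 2 / (2 * ρ)) := by positivity
    have h19 : γ * ((1 - ρ) ^ 2 / (2 * ρ)) = 2 * γ * ((1 - ρ) ^ 2 / (4 * ρ)) := by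
      field_simp
      ring
    have h20 : 5 * η ^ 2 / μ * V ^ 2 = η ^ 2 / μ * V ^ 2 + 4 * η ^ 2 / μ * V ^ 2 := by ring
    have h21 : 0 ≤ μ * d ^ 2 := by positivity
    linarith
  · have h1 := log_two_sub_le_sub_log hρ
    have h2 := mul_le_mul_of_nonneg_left h1 (by positivity : 0 ≤ 4 * γ + μ)
    have h3 := Real.log_two_gt_d9
    have h4 : -(γ * (1 - ρ)) ≤ (1 - ρ) * δ := by nlinarith [neg_le_of_abs_le hδ]
    have h5 : 0 ≤ ρ * D := mul_nonneg hρ.le (le_trans (by positivity) hD)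
    have h6 : B ≤ 6 * η := by
      refine hB'.trans ?_
      have : l + ρ * l ≤ 3 / 2 * η := by nlinarith
      nlinarith
    -- With `log 2 - 1/2 > 0.193`, the coefficients close: `6η ≤ 0.225 γ` and `0.225 + 0.5 < 4 *
    -- 0.193` for `γ`, and `1/8 < 0.193` for `μ`.
    have h7 : μ / 32 * d ^ 2 ≤ μ / 8 := by nlinarith [mul_nonneg hμ.le hd]
    have h8 : 0 ≤ 5 * η ^ 2 / μ * V ^ 2 := by positivity
    have h9 : (4 * γ + μ) * (0.193 + (1 / 2 - ρ)) ≤ (4 * γ + μ) * (Real.log 2 - ρ) := by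
      gcongr
      linarith
    have h10 : 0 ≤ μ * (1 / 2 - ρ) := mul_nonneg hμ.le (by linarith)
    have h11 : 0 ≤ γ * (1 / 2 - ρ) := mul_nonneg hγ.le (by linarith)
    linarith

end Regularizer

/-! ### The lifted objective and the RVU inequality of COFTRL -/

section Online

variable {A : Type*} [Fintype A] {ψ : (A → ℝ) → ℝ} {γ μ α η : ℝ}

/-- The objective of COFTRL, as a function of the learning rate and the strategy jointly. -/
def coftrlObjective (ψ : (A → ℝ) → ℝ) (α : ℝ) (r : A → ℝ) (l : ℝ) (w : A → ℝ) : ℝ :=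
  α * Real.log l + l * (r ⬝ᵥ w) - ψ w

/-- `(l, x)` maximizes the joint objective of COFTRL. -/
structure IsCOFTRLOptimum (ψ : (A → ℝ) → ℝ) (α η : ℝ) (r : A → ℝ) (l : ℝ) (x : A → ℝ) : Prop where
  rate_mem : l ∈ Ioc 0 η
  mem : x ∈ stdSimplex ℝ A
  le : ∀ l' ∈ Ioc 0 η, ∀ w ∈ stdSimplex ℝ A,
    coftrlObjective ψ α r l' w ≤ coftrlObjective ψ α r l x

/-- Nested maximization, first over the strategy and then over the rate, is joint maximization,
since the conjugate at the chosen rate is attained at `x`. -/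
theorem IsCOFTRLStep.exists_optimum (hψ : ContinuousOn ψ (stdSimplex ℝ A)) {r x : A → ℝ}
    (h : IsCOFTRLStep ψ α η r x) : ∃ l, IsCOFTRLOptimum ψ α η r l x := by
  obtain ⟨l, hl, hmaxl, hx, hmaxx⟩ := h
  refine ⟨l, hl, hx, fun l' hl' w hw => ?_⟩
  have hbdd : ∀ g : A → ℝ, BddAbove ((fun x => g ⬝ᵥ x - ψ x) '' stdSimplex ℝ A) := fun g =>
    ((isCompact_stdSimplex ℝ A).image_of_continuousOn
      (ContinuousOn.sub (by unfold dotProduct; fun_prop) hψ)).bddAbove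
  have h1 : simplexConjugate ψ (l • r) ≤ l * (r ⬝ᵥ x) - ψ x := by
    refine csSup_le ⟨_, x, hx, rfl⟩ ?_
    rintro _ ⟨z, hz, rfl⟩
    have : l * (r ⬝ᵥ z) - ψ z ≤ l * (r ⬝ᵥ x) - ψ x := hmaxx hz
    simpa [smul_dotProduct] using this
  have h2 : l' * (r ⬝ᵥ w) - ψ w ≤ simplexConjugate ψ (l' • r) := by
    refine le_csSup (hbdd _) ⟨w, hw, ?_⟩
    simp [smul_dotProduct]
  have h3 : α * Real.log l' + simplexConjugate ψ (l' • r) ≤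
      α * Real.log l + simplexConjugate ψ (l • r) := hmaxl hl'
  unfold coftrlObjective
  linarith

namespace IsCOFTRLOptimum

variable {r x : A → ℝ} {l : ℝ}

theorem isMaxOn (h : IsCOFTRLOptimum ψ α η r l x) :
    IsMaxOn (fun w => (l • r) ⬝ᵥ w - ψ w) (stdSimplex ℝ A) x := by
  intro w hw
  have := h.le l h.rate_mem w hw
  unfold coftrlObjective at this
  simp only [smul_dotProduct, smul_eq_mul, mem_ofPred_eq]
  linarith

/-- First-order optimality of the learning rate. -/
theorem rate_le (hα : 0 ≤ α) (h : IsCOFTRLOptimum ψ α η r l x) {l' : ℝ} (hl' : l' ∈ Ioc 0 η) :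
    (α + l * (r ⬝ᵥ x)) * (l' / l - 1) ≤ 0 := by
  have hl := h.rate_mem
  set e := l' / l - 1 with he
  have hl'e : l' = l * (1 + e) := by rw [he, add_sub_cancel, mul_div_cancel₀ _ hl.1.ne']
  have he1 : 0 < 1 + e := by rw [he, add_sub_cancel]; exact div_pos hl'.1 hl.1
  have hlim : Tendsto (fun s : ℝ => α * (e / (1 + s * e)) + l * (r ⬝ᵥ x) * e) (𝓝[>] 0)
      (𝓝 (α * (e / (1 + 0 * e)) + l * (r ⬝ᵥ x) * e)) := by
    refine Tendsto.mono_left ?_ nhdsWithin_le_nhds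
    refine ContinuousAt.tendsto (f := fun s : ℝ => α * (e / (1 + s * e)) + l * (r ⬝ᵥ x) * e) ?_
    refine ContinuousAt.add (ContinuousAt.mul continuousAt_const
      (ContinuousAt.div continuousAt_const (by fun_prop) (by simp))) continuousAt_const
  have hle : α * (e / (1 + 0 * e)) + l * (r ⬝ᵥ x) * e ≤ 0 := by
    refine le_of_tendsto hlim ?_
    filter_upwards [Ioc_mem_nhdsGT (zero_lt_one' ℝ)] with s hs
    have hs1 : 0 < 1 + s * e := by nlinarith [hs.1, hs.2]
    have hmem : l * (1 + s * e) ∈ Ioc 0 η := by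
      refine ⟨mul_pos hl.1 hs1, ?_⟩
      have : l * (1 + s * e) = (1 - s) * l + s * l' := by rw [hl'e]; ring
      rw [this]
      nlinarith [hs.1, hs.2, hl.2, hl'.2]
    have h1 := h.le _ hmem x h.mem
    unfold coftrlObjective at h1
    rw [Real.log_mul hl.1.ne' hs1.ne'] at h1
    -- Perturb the rate to `l (1 + s e)`, moving toward `l'` so that it stays in `(0, η]` even if `l
    -- = η`; divide by `s` and let `s ↓ 0`.
    have h2 := Real.one_sub_inv_le_log_of_pos hs1
    have h3 : 1 - (1 + s * e)⁻¹ = s * (e / (1 + s * e)) := by field_simp; ring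
    rw [h3] at h2
    have h4 := mul_le_mul_of_nonneg_left h2 hα
    refine nonpos_of_mul_nonpos_right (a := s) ?_ hs.1
    linarith
  simp only [zero_mul, add_zero, div_one] at hle
  linarith

/-- One step of the analysis of optimistic FTRL: `s` is the cumulated signal, `p` its prediction
for the present round, and `u` the signal that is then observed. -/
theorem objective_add_le (h : IsCOFTRLRegularizer ψ γ μ α η) {s p u : A → ℝ}
    (hopt : IsCOFTRLOptimum ψ α η (s + p) l x) (hu : u ⬝ᵥ x = 0) (hup : ‖u - p‖ ≤ 4)
    {l' : ℝ} (hl' : l' ∈ Ioc 0 η) {x' : A → ℝ} (hx' : x' ∈ stdSimplex ℝ A) :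
    coftrlObjective ψ α (s + u) l' x' ≤ coftrlObjective ψ α s l x
      + 5 * η ^ 2 / μ * ‖u - p‖ ^ 2 - μ / 32 * l1Norm (x' - x) ^ 2 := by
  have hl := hopt.rate_mem
  have hx := hopt.mem
  have hlρ : l' / l * l = l' := div_mul_cancel₀ _ hl.1.ne'
  have hrate := hopt.rate_le h.alpha_pos.le hl'
  have hlip := h.lipschitz.sq_le_of_isMaxOn h.gamma_pos.le hx hx' hopt.isMaxOn
  have hcvx := h.convex.sq_le_of_isMaxOn hx hx' hopt.isMaxOn
  have hB : l' * ((u - p) ⬝ᵥ x') - l * ((u - p) ⬝ᵥ x) ≤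
      ‖u - p‖ * (l * |1 - l' / l| + l * l1Norm (x' - x)) := by
    have h1 := le_of_abs_le (abs_dotProduct_le (u - p) (x' - x))
    have h2 : (l' - l) * ((u - p) ⬝ᵥ x') ≤ |l' - l| * ‖u - p‖ := by
      refine (le_abs_self _).trans ?_
      rw [abs_mul]
      exact mul_le_mul_of_nonneg_left (abs_dotProduct_le_norm _ hx') (abs_nonneg _)
    have h3 : |l' - l| = l * |1 - l' / l| := by
      rw [← abs_of_pos hl.1, ← abs_mul, abs_of_pos hl.1, mul_sub, mul_one, mul_comm l (l' / l),
        hlρ, abs_sub_comm]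
    have h4 := mul_le_mul_of_nonneg_left h1 hl.1.le
    rw [dotProduct_sub] at h4
    rw [h3] at h2
    linarith
  have hB' : l' * ((u - p) ⬝ᵥ x') - l * ((u - p) ⬝ᵥ x) ≤ ‖u - p‖ * (l + l' / l * l) := by
    rw [hlρ]
    have h1 := mul_le_mul_of_nonneg_left (le_of_abs_le (abs_dotProduct_le_norm (u - p) hx')) hl'.1.le
    have h2 := mul_le_mul_of_nonneg_left (neg_le_of_abs_le (abs_dotProduct_le_norm (u - p) hx)) hl.1.le
    linarith
  have hδ : |ψ x' - ψ x| ≤ γ :=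
    abs_le.2 ⟨by linarith [h.sub_le_gamma hx' hx], h.sub_le_gamma hx hx'⟩
  have key := gap_step_bound h.gamma_pos h.mu_pos h.le_alpha h.eta_le_gamma
    (div_pos hl'.1 hl.1) hl.1 hl.2 (hlρ.trans_le hl'.2) (norm_nonneg (u - p)) hup
    (l1Norm_nonneg _) (l1Norm_sub_le_two hx' hx) hlip hδ hcvx hB hB'
  have hlog : Real.log l' = Real.log (l' / l) + Real.log l := by
    rw [← Real.log_mul (div_pos hl'.1 hl.1).ne' hl.1.ne', hlρ]
  simp only [coftrlObjective, hlog, smul_dotProduct, smul_eq_mul, dotProduct_sub, sub_dotProduct,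
    add_dotProduct, hu] at key hrate ⊢
  set ρ := l' / l
  rw [← hlρ] at key ⊢
  -- Since `u` is orthogonal to `x`, the leftover `l ⟨p, x⟩` equals `-l ⟨u - p, x⟩`. `hrate` trades
  -- `(ρ - 1) l ⟨s + p, x⟩` for `-α (ρ - 1)`, which turns `α log ρ` into `-α (ρ - 1 - log ρ)`.
  linarith

end IsCOFTRLOptimum

theorem correctedReward_dotProduct (ν x : ℕ → A → ℝ) (t : ℕ) {w : A → ℝ}
    (hw : w ∈ stdSimplex ℝ A) :
    correctedReward ν x t ⬝ᵥ w = ν t ⬝ᵥ w - ν t ⬝ᵥ x t := by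
  have : correctedReward ν x t = ν t - (ν t ⬝ᵥ x t) • (1 : A → ℝ) := by
    ext a; simp [correctedReward]
  rw [this, sub_dotProduct, smul_dotProduct, one_dotProduct, hw.2, smul_eq_mul, mul_one]

theorem norm_correctedReward_le {ν x : ℕ → A → ℝ} {t : ℕ} (hν : ‖ν t‖ ≤ 1)
    (hx : x t ∈ stdSimplex ℝ A) : ‖correctedReward ν x t‖ ≤ 2 := by
  refine (pi_norm_le_iff_of_nonneg (by norm_num)).2 fun a => ?_
  have h1 := norm_le_pi_norm (ν t) a
  have h2 := abs_dotProduct_le_norm (ν t) hx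
  rw [Real.norm_eq_abs] at h1 ⊢
  rw [correctedReward]
  linarith [abs_sub (ν t a) (ν t ⬝ᵥ x t)]

theorem norm_correctedReward_sub_sq_le {ν x : ℕ → A → ℝ} {t : ℕ} (hν : ‖ν t‖ ≤ 1)
    (hx' : x (t + 1) ∈ stdSimplex ℝ A) :
    ‖correctedReward ν x (t + 1) - correctedReward ν x t‖ ^ 2 ≤
      8 * ‖ν (t + 1) - ν t‖ ^ 2 + 2 * l1Norm (x (t + 1) - x t) ^ 2 := by
  have h : ‖correctedReward ν x (t + 1) - correctedReward ν x t‖ ≤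
      2 * ‖ν (t + 1) - ν t‖ + l1Norm (x (t + 1) - x t) := by
    refine (pi_norm_le_iff_of_nonneg (by have := l1Norm_nonneg (x (t + 1) - x t); positivity)).2
      fun a => ?_
    have h1 := norm_le_pi_norm (ν (t + 1) - ν t) a
    have h2 := abs_dotProduct_le_norm (ν (t + 1) - ν t) hx'
    have h3 := abs_dotProduct_le (ν t) (x (t + 1) - x t)
    have h4 := mul_le_mul_of_nonneg_right hν (l1Norm_nonneg (x (t + 1) - x t))
    have h5 : (correctedReward ν x (t + 1) - correctedReward ν x t) a =
        (ν (t + 1) - ν t) a - (ν (t + 1) - ν t) ⬝ᵥ x (t + 1) - ν t ⬝ᵥ (x (t + 1) - x t) := by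
      simp only [correctedReward, Pi.sub_apply, sub_dotProduct, dotProduct_sub]
      ring
    rw [Real.norm_eq_abs] at h1 ⊢
    rw [h5]
    linarith [abs_sub ((ν (t + 1) - ν t) a - (ν (t + 1) - ν t) ⬝ᵥ x (t + 1))
      (ν t ⬝ᵥ (x (t + 1) - x t)), abs_sub ((ν (t + 1) - ν t) a) ((ν (t + 1) - ν t) ⬝ᵥ x (t + 1))]
  nlinarith [norm_nonneg (correctedReward ν x (t + 1) - correctedReward ν x t),
    sq_nonneg (2 * ‖ν (t + 1) - ν t‖ - l1Norm (x (t + 1) - x t))]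

/-- Sum of the squared `ℓ₁` movements of the first `T` strategies. -/
def strategyVariation (x : ℕ → A → ℝ) (T : ℕ) : ℝ :=
  ∑ t ∈ Finset.range (T - 1), l1Norm (x (t + 1) - x t) ^ 2

theorem strategyVariation_nonneg (x : ℕ → A → ℝ) (T : ℕ) : 0 ≤ strategyVariation x T :=
  Finset.sum_nonneg fun _ _ => sq_nonneg _

variable {ν x : ℕ → A → ℝ}

theorem norm_predictionError_le {t : ℕ} (hν : ∀ τ ≤ t, ‖ν τ‖ ≤ 1)
    (hx : ∀ τ ≤ t, x τ ∈ stdSimplex ℝ A) :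
    ‖correctedReward ν x t - (if t = 0 then 0 else correctedReward ν x (t - 1))‖ ≤ 4 := by
  refine (norm_sub_le _ _).trans ?_
  have h1 := norm_correctedReward_le (hν t le_rfl) (hx t le_rfl)
  split_ifs with h
  · rw [norm_zero]; linarith
  · have h2 := norm_correctedReward_le (hν (t - 1) (Nat.sub_le _ _)) (hx (t - 1) (Nat.sub_le _ _))
    linarith

/-- Telescoping of the COFTRL objective over the rounds up to `t`. -/
theorem coftrlObjective_sum_le (h : IsCOFTRLRegularizer ψ γ μ α η)
    {l : ℕ → ℝ} {t : ℕ} (hν : ∀ τ ≤ t, ‖ν τ‖ ≤ 1)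
    (hopt : ∀ τ ≤ t, IsCOFTRLOptimum ψ α η (optimisticRegret ν x τ) (l τ) (x τ)) :
    coftrlObjective ψ α (∑ τ ∈ Finset.range t, correctedReward ν x τ) (l t) (x t) ≤
      α * Real.log η - ψ (x 0)
      + 5 * η ^ 2 / μ * ∑ τ ∈ Finset.range t, ‖correctedReward ν x τ -
          (if τ = 0 then 0 else correctedReward ν x (τ - 1))‖ ^ 2
      - μ / 32 * ∑ τ ∈ Finset.range t, l1Norm (x (τ + 1) - x τ) ^ 2 := by
  induction t with
  | zero =>
    have h0 := (hopt 0 le_rfl).rate_mem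
    simp only [coftrlObjective, Finset.range_zero, Finset.sum_empty, zero_dotProduct]
    have := mul_le_mul_of_nonneg_left (Real.log_le_log h0.1 h0.2) h.alpha_pos.le
    linarith
  | succ t ih =>
    have ih := ih (fun τ hτ => hν τ (hτ.trans t.le_succ)) fun τ hτ => hopt τ (hτ.trans t.le_succ)
    have ht := hopt t t.le_succ
    have ht' := hopt (t + 1) le_rfl
    have hstep := IsCOFTRLOptimum.objective_add_le h ht
      (u := correctedReward ν x t)
      (by rw [correctedReward_dotProduct _ _ _ ht.mem, sub_self])
      (norm_predictionError_le (fun τ hτ => hν τ (hτ.trans t.le_succ)) fun τ hτ =>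
        (hopt τ (hτ.trans t.le_succ)).mem)
      ht'.rate_mem ht'.mem
    rw [Finset.sum_range_succ, Finset.sum_range_succ, Finset.sum_range_succ]
    linarith

/-- The "regret bounded by variation in utilities" property of COFTRL, in the lifted space. -/
theorem IsCOFTRLStep.rvu (h : IsCOFTRLRegularizer ψ γ μ α η) {T : ℕ} (hT : 1 ≤ T)
    (hν : ∀ t < T, ‖ν t‖ ≤ 1)
    (hstep : ∀ t < T, IsCOFTRLStep ψ α η (optimisticRegret ν x t) (x t))
    {l : ℝ} (hl : l ∈ Ioc 0 η) {w : A → ℝ} (hw : w ∈ stdSimplex ℝ A) :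
    l * ∑ t ∈ Finset.range T, (ν t ⬝ᵥ w - ν t ⬝ᵥ x t) ≤
      α * Real.log (η / l) + regularizerRange ψ + η / 2
        + 40 * η ^ 2 / μ * utilityVariation ν T - μ / 40 * strategyVariation x T := by
  obtain ⟨k, rfl⟩ : ∃ k, T = k + 1 := ⟨T - 1, by omega⟩
  have hex : ∀ t, ∃ l, t < k + 1 → IsCOFTRLOptimum ψ α η (optimisticRegret ν x t) l (x t) := by
    intro t
    by_cases ht : t < k + 1
    · obtain ⟨l, hl⟩ := (hstep t ht).exists_optimum h.continuousOn
      exact ⟨l, fun _ => hl⟩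
    · exact ⟨0, fun h => absurd h ht⟩
  choose lr hlr using hex
  have hmem : ∀ t ≤ k, x t ∈ stdSimplex ℝ A := fun t ht => (hlr t (by omega)).mem
  have hν : ∀ t ≤ k, ‖ν t‖ ≤ 1 := fun t ht => hν t (by omega)
  have h1 := coftrlObjective_sum_le h hν (t := k) (fun τ hτ => hlr τ (by omega))
  -- The comparator `(l, w)` takes the place of the next iterate in the last step.
  have h2 := IsCOFTRLOptimum.objective_add_le h (hlr k (by omega)) (u := correctedReward ν x k)
    (by rw [correctedReward_dotProduct _ _ _ (hmem k le_rfl), sub_self])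
    (norm_predictionError_le hν hmem) hl hw
  rw [← Finset.sum_range_succ] at h2
  have h3 : (∑ t ∈ Finset.range (k + 1), correctedReward ν x t) ⬝ᵥ w =
      ∑ t ∈ Finset.range (k + 1), (ν t ⬝ᵥ w - ν t ⬝ᵥ x t) := by
    rw [sum_dotProduct]
    exact Finset.sum_congr rfl fun t _ => correctedReward_dotProduct _ _ _ hw
  have h4 : ∑ τ ∈ Finset.range (k + 1), ‖correctedReward ν x τ -
      (if τ = 0 then 0 else correctedReward ν x (τ - 1))‖ ^ 2 ≤
      8 * utilityVariation ν (k + 1) + 2 * strategyVariation x (k + 1) + 4 := by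
    -- Round `0` is split off: its prediction is zero, so its squared error is at most `2² = 4`.
    rw [Finset.sum_range_succ', utilityVariation, strategyVariation, Nat.add_sub_cancel,
      Finset.mul_sum, Finset.mul_sum, ← Finset.sum_add_distrib]
    refine add_le_add (Finset.sum_le_sum fun t ht => ?_) ?_
    · have ht := Finset.mem_range.1 ht
      simpa using norm_correctedReward_sub_sq_le (hν t ht.le) (hmem (t + 1) ht)
    · have := norm_correctedReward_le (hν 0 (Nat.zero_le _)) (hmem 0 (Nat.zero_le _))
      simp only [if_true, sub_zero]
      nlinarith [norm_nonneg (correctedReward ν x 0)]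
  rw [Finset.sum_range_succ] at h4
  have h5 := h.sub_le_regularizerRange (hmem 0 (Nat.zero_le _)) hw
  have hμ := h.mu_pos
  have hη := h.eta_pos
  have h6 : 0 ≤ μ / 32 * l1Norm (w - x k) ^ 2 := by positivity
  have h7 := mul_le_mul_of_nonneg_left h4 (by positivity : 0 ≤ 5 * η ^ 2 / μ)
  -- From `45 η ≤ μ`: the initial error `20 η² / μ` is below `η / 2`, and the movement term `10 η² /
  -- μ` fits into `μ / 32 - μ / 40`.
  have h8 : 45 * η ^ 2 / μ ≤ η := by
    rw [div_le_iff₀ hμ]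
    nlinarith [h.mul_eta_le_mu, h.eta_pos]
  have h9 : 2025 * η ^ 2 / μ ≤ μ := by
    rw [div_le_iff₀ hμ]
    nlinarith [h.mul_eta_le_mu, h.eta_pos]
  have h10 : Real.log (η / l) = Real.log η - Real.log l :=
    Real.log_div h.eta_pos.ne' hl.1.ne'
  have h11 : strategyVariation x (k + 1) = ∑ τ ∈ Finset.range k, l1Norm (x (τ + 1) - x τ) ^ 2 := rfl
  have h12 := strategyVariation_nonneg x (k + 1)
  have h13 := mul_le_mul_of_nonneg_right h9 h12
  rw [coftrlObjective, h3] at h2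
  rw [h10]
  rw [← h11] at h1
  have e1 : ∀ c : ℝ, c * η ^ 2 / μ = c * (η ^ 2 / μ) := fun c => mul_div_assoc _ _ _
  simp only [e1] at *
  generalize η ^ 2 / μ = q at *
  have h14 : 0 ≤ μ * strategyVariation x (k + 1) := mul_nonneg hμ.le h12
  linarith

end Online

/-! ### Regret as a supremum over comparators -/

section Regret

variable {A : Type*} [Fintype A] {ν x : ℕ → A → ℝ} {T : ℕ}

theorem sum_le_regret (ν x : ℕ → A → ℝ) (T : ℕ) {w : A → ℝ} (hw : w ∈ stdSimplex ℝ A) :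
    ∑ t ∈ Finset.range T, (ν t ⬝ᵥ w - ν t ⬝ᵥ x t) ≤ regret ν x T := by
  have hcont : ContinuousOn (fun z => ∑ t ∈ Finset.range T, ν t ⬝ᵥ z) (stdSimplex ℝ A) := by
    unfold dotProduct
    fun_prop
  rw [Finset.sum_sub_distrib]
  exact sub_le_sub_right
    (le_csSup ((isCompact_stdSimplex ℝ A).image_of_continuousOn hcont).bddAbove ⟨w, hw, rfl⟩) _

theorem regret_le_of_forall [Nonempty A] {b : ℝ}
    (h : ∀ w ∈ stdSimplex ℝ A, ∑ t ∈ Finset.range T, (ν t ⬝ᵥ w - ν t ⬝ᵥ x t) ≤ b) :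
    regret ν x T ≤ b := by
  rw [regret, sub_le_iff_le_add]
  refine csSup_le (nonempty_stdSimplex.image _) ?_
  rintro _ ⟨w, hw, rfl⟩
  have := h w hw
  rw [Finset.sum_sub_distrib] at this
  linarith

theorem abs_dotProduct_sub_dotProduct_le {v w z : A → ℝ} (hv : ‖v‖ ≤ 1)
    (hw : w ∈ stdSimplex ℝ A) (hz : z ∈ stdSimplex ℝ A) : |v ⬝ᵥ w - v ⬝ᵥ z| ≤ 2 := by
  have h1 := abs_dotProduct_le_norm v hw
  have h2 := abs_dotProduct_le_norm v hz
  linarith [abs_sub (v ⬝ᵥ w) (v ⬝ᵥ z)]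

end Regret

/-! ### Multiplicative weights with decreasing step sizes -/

section MultiplicativeWeights

variable {A : Type*} [Fintype A]

/-- The potential `log (mean (exp (e S))) / e` of multiplicative weights with step size `e`. -/
def mwuPotential (e : ℝ) (S : A → ℝ) : ℝ :=
  Real.log (∑ a, (Fintype.card A : ℝ)⁻¹ * Real.exp (e * S a)) / e

theorem sum_inv_card_mul_exp_pos [Nonempty A] (f : A → ℝ) :
    0 < ∑ a, (Fintype.card A : ℝ)⁻¹ * Real.exp (f a) :=
  Finset.sum_pos (fun _ _ => mul_pos (inv_pos.2 (Nat.cast_pos.2 Fintype.card_pos))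
    (Real.exp_pos _)) Finset.univ_nonempty

/-- The power mean inequality with exponent `e / e' ≥ 1`. It allows the step size to decrease
between rounds at no cost, which is why the potential uses the mean rather than the sum. -/
theorem mwuPotential_mono [Nonempty A] {e e' : ℝ} (he' : 0 < e') (h : e' ≤ e) (S : A → ℝ) :
    mwuPotential e' S ≤ mwuPotential e S := by
  have he : 0 < e := he'.trans_le h
  have hN : (0 : ℝ) < Fintype.card A := Nat.cast_pos.2 Fintype.card_pos
  have h1 := Real.rpow_arith_mean_le_arith_mean_rpow Finset.univ
    (fun _ : A => (Fintype.card A : ℝ)⁻¹) (fun a => Real.exp (e' * S a))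
    (fun _ _ => (inv_pos.2 hN).le) (by simp [hN.ne'])
    (fun _ _ => (Real.exp_pos _).le) ((one_le_div he').2 h)
  have h2 : ∀ a : A, Real.exp (e' * S a) ^ (e / e') = Real.exp (e * S a) := by
    intro a
    rw [← Real.exp_mul]
    congr 1
    field_simp
  simp only [h2] at h1
  have h3 := Real.log_le_log (Real.rpow_pos_of_pos (sum_inv_card_mul_exp_pos _) _) h1
  rw [Real.log_rpow (sum_inv_card_mul_exp_pos _)] at h3
  rw [mwuPotential, mwuPotential, le_div_iff₀ he]
  calc _ = e / e' * Real.log (∑ a, (Fintype.card A : ℝ)⁻¹ * Real.exp (e' * S a)) := by ring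
    _ ≤ _ := h3

theorem le_mwuPotential_add [Nonempty A] {e : ℝ} (he : 0 < e) (S : A → ℝ) (a : A) :
    S a ≤ mwuPotential e S + Real.log (Fintype.card A) / e := by
  have hN : (0 : ℝ) < Fintype.card A := Nat.cast_pos.2 Fintype.card_pos
  have h1 : (Fintype.card A : ℝ)⁻¹ * Real.exp (e * S a) ≤
      ∑ a, (Fintype.card A : ℝ)⁻¹ * Real.exp (e * S a) :=
    Finset.single_le_sum (f := fun a => (Fintype.card A : ℝ)⁻¹ * Real.exp (e * S a))
      (fun _ _ => mul_nonneg (inv_pos.2 hN).le (Real.exp_pos _).le) (Finset.mem_univ a)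
  have h2 := Real.log_le_log (mul_pos (inv_pos.2 hN) (Real.exp_pos _)) h1
  rw [Real.log_mul (inv_pos.2 hN).ne' (Real.exp_pos _).ne', Real.log_exp, Real.log_inv] at h2
  rw [mwuPotential, ← add_div, le_div_iff₀ he]
  linarith

theorem log_sum_mul_exp_le {p v : A → ℝ} (hp : p ∈ stdSimplex ℝ A) (hv : ‖v‖ ≤ 1) {e : ℝ}
    (he : 0 < e) : Real.log (∑ a, p a * Real.exp (e * v a)) ≤ e * (v ⬝ᵥ p) + 2 * e ^ 2 := by
  have hva : ∀ a, |v a| ≤ 1 := fun a => (norm_le_pi_norm v a).trans hv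
  have hpos : 0 < ∑ a, p a * Real.exp (e * v a) := by
    have hnn : ∀ a ∈ Finset.univ, 0 ≤ p a * Real.exp (e * v a) := fun a _ =>
      mul_nonneg (hp.1 a) (Real.exp_pos _).le
    refine (Finset.sum_nonneg hnn).lt_of_ne fun h0 => ?_
    have h1 := (Finset.sum_eq_zero_iff_of_nonneg hnn).1 h0.symm
    have h2 : ∑ a, p a = 0 := Finset.sum_eq_zero fun a ha =>
      (mul_eq_zero.1 (h1 a ha)).resolve_right (Real.exp_pos _).ne'
    linarith [hp.2]
  -- For `e ≤ 1`, use `exp y ≤ 1 + y + y²`; for `e ≥ 1`, the trivial bound `e` suffices because `-e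
  -- + 2e² ≥ e`.
  rcases le_total e 1 with h | h
  · have h1 : ∑ a, p a * Real.exp (e * v a) ≤ 1 + e * (v ⬝ᵥ p) + e ^ 2 := by
      have h2 : 1 + e * (v ⬝ᵥ p) + e ^ 2 = ∑ a, p a * (1 + e * v a + e ^ 2) := by
        have h3 : ∀ a, p a * (1 + e * v a + e ^ 2) = p a + e * (v a * p a) + p a * e ^ 2 :=
          fun a => by ring
        simp only [h3, Finset.sum_add_distrib, ← Finset.mul_sum, ← Finset.sum_mul, hp.2,
          dotProduct, one_mul]
      rw [h2]
      refine Finset.sum_le_sum fun a _ => mul_le_mul_of_nonneg_left ?_ (hp.1 a)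
      have h4 : |e * v a| ≤ 1 := by
        rw [abs_mul, abs_of_pos he]
        exact mul_le_one₀ h (abs_nonneg _) (hva a)
      have h5 := (abs_le.1 (Real.abs_exp_sub_one_sub_id_le h4)).2
      have h6 : (e * v a) ^ 2 ≤ e ^ 2 := by
        rw [mul_pow]
        exact mul_le_of_le_one_right (sq_nonneg e) ((sq_le_one_iff_abs_le_one _).2 (hva a))
      linarith
    have h7 := Real.log_le_sub_one_of_pos hpos
    nlinarith [sq_nonneg e]
  · have h1 : ∑ a, p a * Real.exp (e * v a) ≤ Real.exp e := by
      rw [← one_mul (Real.exp e), ← hp.2, Finset.sum_mul]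
      refine Finset.sum_le_sum fun a _ => mul_le_mul_of_nonneg_left ?_ (hp.1 a)
      rw [Real.exp_le_exp]
      exact mul_le_of_le_one_right he.le ((le_abs_self _).trans (hva a))
    have h2 := Real.log_le_log hpos h1
    rw [Real.log_exp] at h2
    have h3 := neg_le_of_abs_le ((abs_dotProduct_le_norm v hp).trans hv)
    nlinarith

theorem mwu_play_apply [Nonempty A] (ν : ℕ → A → ℝ) (t : ℕ) (a : A) :
    (mwu A).play ν t a =
      Real.exp (Real.sqrt (Real.log (Fintype.card A) / (t + 1)) *
          ∑ k ∈ Finset.range t, ν k a) /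
        ∑ b, Real.exp (Real.sqrt (Real.log (Fintype.card A) / (t + 1)) *
          ∑ k ∈ Finset.range t, ν k b) := by
  simp only [OnlineAlgorithm.play, mwu, Finset.sum_range]
  rfl

theorem mwuPotential_step [Nonempty A] (hN : 1 < Fintype.card A) (ν : ℕ → A → ℝ)
    (hν : ∀ t, ‖ν t‖ ≤ 1) (t : ℕ) :
    mwuPotential (Real.sqrt (Real.log (Fintype.card A) / (t + 1)))
        (∑ k ∈ Finset.range (t + 1), ν k) ≤
      mwuPotential (Real.sqrt (Real.log (Fintype.card A) / (t + 1)))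
        (∑ k ∈ Finset.range t, ν k)
        + ν t ⬝ᵥ (mwu A).play ν t
        + 2 * Real.sqrt (Real.log (Fintype.card A) / (t + 1)) := by
  have hlogN : 0 < Real.log (Fintype.card A) := Real.log_pos (by exact_mod_cast hN)
  have he : 0 < Real.sqrt (Real.log (Fintype.card A) / (t + 1)) :=
    Real.sqrt_pos.2 (by positivity)
  have hp : (mwu A).play ν t ∈ stdSimplex ℝ A := ((mwu A) t fun k => ν k).2
  have hplay := mwu_play_apply ν t
  set e := Real.sqrt (Real.log (Fintype.card A) / (t + 1)) with he_def
  set p := (mwu A).play ν t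
  set N : ℝ := (Fintype.card A : ℝ)
  have hNpos : 0 < N := Nat.cast_pos.2 Fintype.card_pos
  have hW : 0 < ∑ b, Real.exp (e * ∑ k ∈ Finset.range t, ν k b) :=
    Finset.sum_pos (fun _ _ => Real.exp_pos _) Finset.univ_nonempty
  -- The weights are the normalized exponentials, so the new mean is the old one times the
  -- expectation under the played strategy.
  have hsplit : ∑ a, N⁻¹ * Real.exp (e * (∑ k ∈ Finset.range (t + 1), ν k) a) =
      (∑ a, N⁻¹ * Real.exp (e * (∑ k ∈ Finset.range t, ν k) a)) *
        ∑ a, p a * Real.exp (e * ν t a) := by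
    rw [Finset.mul_sum]
    refine Finset.sum_congr rfl fun a _ => ?_
    rw [← Finset.mul_sum, hplay]
    simp only [Finset.sum_apply, Finset.sum_range_succ, mul_add, Real.exp_add]
    field_simp
  have hpos := sum_inv_card_mul_exp_pos (fun a : A => e * (∑ k ∈ Finset.range t, ν k) a)
  have hpos' := sum_inv_card_mul_exp_pos (fun a : A => e * (∑ k ∈ Finset.range (t + 1), ν k) a)
  have hne : ∑ a, p a * Real.exp (e * ν t a) ≠ 0 := by
    intro h0
    rw [hsplit, h0, mul_zero] at hpos'
    exact lt_irrefl _ hpos'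
  have hlog := log_sum_mul_exp_le hp (hν t) he
  rw [mwuPotential, mwuPotential, hsplit, Real.log_mul hpos.ne' hne, add_div, add_assoc]
  refine add_le_add_right ?_ _
  rw [div_le_iff₀ he]
  linarith

theorem mwuPotential_le_sum [Nonempty A] (hN : 1 < Fintype.card A) (ν : ℕ → A → ℝ)
    (hν : ∀ t, ‖ν t‖ ≤ 1) (T : ℕ) :
    mwuPotential (Real.sqrt (Real.log (Fintype.card A) / (T + 1)))
        (∑ k ∈ Finset.range T, ν k) ≤
      ∑ t ∈ Finset.range T, ν t ⬝ᵥ (mwu A).play ν t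
        + 4 * Real.sqrt (T * Real.log (Fintype.card A)) := by
  have hlogN : 0 < Real.log (Fintype.card A) := Real.log_pos (by exact_mod_cast hN)
  have hNpos : (0 : ℝ) < Fintype.card A := Nat.cast_pos.2 Fintype.card_pos
  induction T with
  | zero => simp [mwuPotential, hNpos.ne']
  | succ T ih =>
    have h1 := mwuPotential_step hN ν hν T
    have h2 : mwuPotential (Real.sqrt (Real.log (Fintype.card A) / ((T + 1 : ℕ) + 1)))
        (∑ k ∈ Finset.range (T + 1), ν k) ≤
        mwuPotential (Real.sqrt (Real.log (Fintype.card A) / (T + 1)))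
        (∑ k ∈ Finset.range (T + 1), ν k) := by
      refine mwuPotential_mono (Real.sqrt_pos.2 (by positivity)) (Real.sqrt_le_sqrt ?_) _
      refine div_le_div_of_nonneg_left hlogN.le (by positivity) ?_
      push_cast
      linarith
    have h3 : 2 * Real.sqrt (Real.log (Fintype.card A) / (T + 1)) ≤
        4 * Real.sqrt ((T + 1 : ℕ) * Real.log (Fintype.card A)) -
          4 * Real.sqrt (T * Real.log (Fintype.card A)) := by
      push_cast
      rw [Real.sqrt_mul (by positivity), Real.sqrt_mul (by positivity), Real.sqrt_div' _ (by positivity)]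
      have ha : 0 < Real.sqrt ((T : ℝ) + 1) := Real.sqrt_pos.2 (by positivity)
      have hb : 0 ≤ Real.sqrt (T : ℝ) := Real.sqrt_nonneg _
      have ha2 : Real.sqrt ((T : ℝ) + 1) ^ 2 = T + 1 := Real.sq_sqrt (by positivity)
      have hb2 : Real.sqrt (T : ℝ) ^ 2 = T := Real.sq_sqrt (by positivity)
      have hc : 0 ≤ Real.sqrt (Real.log (Fintype.card A)) := Real.sqrt_nonneg _
      set a := Real.sqrt ((T : ℝ) + 1)
      set b := Real.sqrt (T : ℝ)
      set c := Real.sqrt (Real.log (Fintype.card A))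
      -- `1 = a² - b² = (a - b)(a + b)` and `b ≤ a`; this makes the step sizes telescope into square
      -- roots.
      have h4 : 1 ≤ 2 * a * (a - b) := by nlinarith [sq_nonneg (a - b)]
      have h5 : c / a ≤ 2 * c * (a - b) := by
        rw [div_le_iff₀ ha]
        nlinarith
      linarith
    rw [Finset.sum_range_succ (fun t => ν t ⬝ᵥ (mwu A).play ν t)]
    linarith

/-- The regret of multiplicative weights update with decreasing step sizes. -/
theorem mwu_hasRegretBound [Nontrivial A] {C : ℝ} (hC : 6 ≤ C) : (mwu A).HasRegretBound C := by
  intro ν hν T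
  have hN : 1 < Fintype.card A := Fintype.one_lt_card
  have hlogN : 0 < Real.log (Fintype.card A) := Real.log_pos (by exact_mod_cast hN)
  refine regret_le_of_forall fun w hw => ?_
  rcases Nat.eq_zero_or_pos T with rfl | hT
  · simp
  have hT1 : (1 : ℝ) ≤ T := by exact_mod_cast hT
  have he : 0 < Real.sqrt (Real.log (Fintype.card A) / (T + 1)) := Real.sqrt_pos.2 (by positivity)
  have h1 := mwuPotential_le_sum hN ν hν T
  have h2 : Real.log (Fintype.card A) / Real.sqrt (Real.log (Fintype.card A) / (T + 1)) ≤
      2 * Real.sqrt (T * Real.log (Fintype.card A)) := by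
    rw [div_le_iff₀ he, mul_assoc, ← Real.sqrt_mul (by positivity)]
    have h3 : Real.log (Fintype.card A) / 2 ≤ Real.sqrt (T * Real.log (Fintype.card A) *
        (Real.log (Fintype.card A) / (T + 1))) := by
      refine Real.le_sqrt_of_sq_le ?_
      rw [mul_div_assoc', le_div_iff₀ (by positivity)]
      nlinarith [sq_nonneg (Real.log (Fintype.card A))]
    linarith
  have h4 : ∑ t ∈ Finset.range T, ν t ⬝ᵥ w ≤
      mwuPotential (Real.sqrt (Real.log (Fintype.card A) / (T + 1)))
        (∑ k ∈ Finset.range T, ν k)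
      + Real.log (Fintype.card A) / Real.sqrt (Real.log (Fintype.card A) / (T + 1)) := by
    rw [← sum_dotProduct, dotProduct]
    refine (Finset.sum_le_sum fun a _ => mul_le_mul_of_nonneg_right
      (le_mwuPotential_add he (∑ k ∈ Finset.range T, ν k) a) (hw.1 a)).trans ?_
    rw [← Finset.mul_sum, hw.2, mul_one]
  have h5 := mul_le_mul_of_nonneg_right hC (Real.sqrt_nonneg (T * Real.log (Fintype.card A)))
  rw [Finset.sum_sub_distrib]
  linarith

end MultiplicativeWeights

/-! ### Regret below the switching threshold, and after a switch -/

section Threshold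

variable {A : Type*} [Fintype A] {ψ : (A → ℝ) → ℝ} {γ μ α η L R : ℝ} {n T : ℕ}
  {ν x : ℕ → A → ℝ}

theorem IsCOFTRLRegularizer.regularizerRange_nonneg [Nonempty A]
    (h : IsCOFTRLRegularizer ψ γ μ α η) : 0 ≤ regularizerRange ψ := by
  obtain ⟨x, hx⟩ := nonempty_stdSimplex (A := A)
  simpa using h.sub_le_regularizerRange hx hx

theorem IsCOFTRLRegularizer.log_add_nonneg [Nonempty A] (h : IsCOFTRLRegularizer ψ γ μ α η)
    (hR : regularizerRange ψ ≤ R) (T : ℕ) : 0 ≤ α * Real.log T + R :=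
  add_nonneg (mul_nonneg h.alpha_pos.le (Real.log_natCast_nonneg T))
    (h.regularizerRange_nonneg.trans hR)

theorem IsCOFTRLRegularizer.smoothness_sq_le (h : IsCOFTRLRegularizer ψ γ μ α η) (hL : 0 ≤ L)
    (hLη : 32 * Real.sqrt 6 * L * n * η ≤ μ) : 6144 * (L ^ 2 * n ^ 2 * η ^ 2) ≤ μ ^ 2 := by
  have h0 : 0 ≤ 32 * Real.sqrt 6 * L * n * η := by have := h.eta_pos; positivity
  have h1 := pow_le_pow_left₀ h0 hLη 2
  have h2 : Real.sqrt 6 ^ 2 = 6 := Real.sq_sqrt (by norm_num)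
  have h3 : (32 * Real.sqrt 6 * L * n * η) ^ 2 =
      1024 * Real.sqrt 6 ^ 2 * (L ^ 2 * n ^ 2 * η ^ 2) := by ring
  rw [h3, h2] at h1
  linarith

theorem switchThreshold_eq (hη : η ≠ 0) :
    switchThreshold n L μ α η R T =
      L ^ 2 * n ^ 2 * (128 / μ) * (3 * η + (α * Real.log T + R)) := by
  rw [switchThreshold]
  field_simp

theorem IsCOFTRLRegularizer.switchThreshold_nonneg [Nonempty A]
    (h : IsCOFTRLRegularizer ψ γ μ α η) (hR : regularizerRange ψ ≤ R) (T : ℕ) :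
    0 ≤ switchThreshold n L μ α η R T := by
  have h1 := h.log_add_nonneg hR T
  have h2 := h.eta_pos
  have h3 := h.mu_pos
  rw [switchThreshold]
  positivity

/-- COFTRL has logarithmic regret as long as the variation of the utilities is below the
threshold of the switching rule. -/
theorem IsCOFTRLStep.sum_le_of_utilityVariation_le [Nonempty A]
    (h : IsCOFTRLRegularizer ψ γ μ α η) (hR : regularizerRange ψ ≤ R) (hL : 0 ≤ L)
    (hLη : 32 * Real.sqrt 6 * L * n * η ≤ μ) (hT : 1 ≤ T) (hν : ∀ t < T, ‖ν t‖ ≤ 1)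
    (hstep : ∀ t < T, IsCOFTRLStep ψ α η (optimisticRegret ν x t) (x t))
    (hvar : utilityVariation ν T ≤ switchThreshold n L μ α η R T)
    {w : A → ℝ} (hw : w ∈ stdSimplex ℝ A) :
    ∑ t ∈ Finset.range T, (ν t ⬝ᵥ w - ν t ⬝ᵥ x t) ≤ 6 + 2 * (α * Real.log T + R) / η := by
  have hη := h.eta_pos
  have hμ := h.mu_pos
  -- The rate `l = η` makes the logarithm vanish; `log T` enters only through the threshold.
  have hrvu := IsCOFTRLStep.rvu h hT hν hstep (right_mem_Ioc.2 hη) hw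
  have hP := strategyVariation_nonneg x T
  have hZ := h.log_add_nonneg hR T
  have hlog : 0 ≤ α * Real.log T := mul_nonneg h.alpha_pos.le (Real.log_natCast_nonneg T)
  rw [div_self hη.ne', Real.log_one, mul_zero] at hrvu
  rw [switchThreshold_eq hη.ne'] at hvar
  have hsq := h.smoothness_sq_le hL hLη
  have h1 := mul_le_mul_of_nonneg_left hvar (by positivity : 0 ≤ 40 * η ^ 2 / μ)
  -- The constants match because `40 * 128 = 5120 ≤ 6144 = 32² * 6`.
  have h2 : 40 * η ^ 2 / μ * (L ^ 2 * n ^ 2 * (128 / μ) * (3 * η + (α * Real.log T + R))) ≤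
      3 * η + (α * Real.log T + R) := by
    have h3 : 40 * η ^ 2 / μ * (L ^ 2 * n ^ 2 * (128 / μ) * (3 * η + (α * Real.log T + R))) =
        5120 * (L ^ 2 * n ^ 2 * η ^ 2) / μ ^ 2 * (3 * η + (α * Real.log T + R)) := by
      field_simp
      ring
    rw [h3]
    refine mul_le_of_le_one_left (by positivity) ?_
    rw [div_le_one (by positivity)]
    have : 0 ≤ L ^ 2 * n ^ 2 * η ^ 2 := by positivity
    linarith
  have h4 : 0 ≤ μ / 40 * strategyVariation x T := by positivity
  have h5 : 6 + 2 * (α * Real.log T + R) / η = (6 * η + 2 * (α * Real.log T + R)) / η := by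
    field_simp
  rw [h5, le_div_iff₀ hη]
  linarith

/-- The variant with one more round, in which the threshold may be exceeded. -/
theorem IsCOFTRLStep.sum_succ_le_of_utilityVariation_le [Nonempty A]
    (h : IsCOFTRLRegularizer ψ γ μ α η) (hR : regularizerRange ψ ≤ R) (hL : 0 ≤ L)
    (hLη : 32 * Real.sqrt 6 * L * n * η ≤ μ) (hν : ∀ t, ‖ν t‖ ≤ 1)
    (hstep : ∀ t < T + 1, IsCOFTRLStep ψ α η (optimisticRegret ν x t) (x t))
    (hvar : utilityVariation ν T ≤ switchThreshold n L μ α η R T)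
    {w : A → ℝ} (hw : w ∈ stdSimplex ℝ A) :
    ∑ t ∈ Finset.range (T + 1), (ν t ⬝ᵥ w - ν t ⬝ᵥ x t) ≤
      8 + 2 * (α * Real.log (T + 1 : ℕ) + R) / η := by
  obtain ⟨_, _, _, hx, _⟩ := hstep T (Nat.lt_succ_self T)
  have hlast := le_of_abs_le (abs_dotProduct_sub_dotProduct_le (hν T) hw hx)
  rw [Finset.sum_range_succ]
  rcases Nat.eq_zero_or_pos T with rfl | hT
  · have h1 := h.log_add_nonneg hR (0 + 1)
    have h2 : 0 ≤ 2 * (α * Real.log (0 + 1 : ℕ) + R) / η := by have := h.eta_pos; positivity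
    rw [Finset.range_zero, Finset.sum_empty]
    linarith
  · have h1 := IsCOFTRLStep.sum_le_of_utilityVariation_le h hR hL hLη hT (fun t _ => hν t)
      (fun t ht => hstep t (ht.trans (Nat.lt_succ_self T))) hvar hw
    have h2 : 2 * (α * Real.log T + R) / η ≤ 2 * (α * Real.log (T + 1 : ℕ) + R) / η := by
      have := h.eta_pos
      have := h.alpha_pos
      have : (0 : ℝ) < T := Nat.cast_pos.2 hT
      gcongr
      omega
    linarith

/-- Regret of COFTRL with the switching rule against arbitrary bounded utilities. -/
theorem IsSwitchingCOFTRL.regret_le [Nontrivial A] (h : IsCOFTRLRegularizer ψ γ μ α η)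
    (hR : regularizerRange ψ ≤ R) (hL : 0 ≤ L) (hLη : 32 * Real.sqrt 6 * L * n * η ≤ μ)
    {B : OnlineAlgorithm A} {c : ℝ} (hB : B.HasRegretBound c) (hν : ∀ t, ‖ν t‖ ≤ 1)
    (hsw : IsSwitchingCOFTRL ψ α η (switchThreshold n L μ α η R) B ν x) (hT : 1 ≤ T) :
    regret ν x T ≤ 8 + 2 * (α * Real.log T + R) / η
      + c * Real.sqrt (T * Real.log (Fintype.card A)) := by
  have hlogN : 0 < Real.log (Fintype.card A) :=
    Real.log_pos (by exact_mod_cast Fintype.one_lt_card)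
  -- Test the fallback guarantee on a single round of zero utilities.
  have hc : 0 ≤ c := by
    obtain ⟨w, hw⟩ := nonempty_stdSimplex (A := A)
    have h1 := (sum_le_regret 0 (B.play 0) 1 hw).trans
      (hB 0 (fun t => by simp) 1)
    simp only [Pi.zero_apply, zero_dotProduct, sub_self, Finset.sum_const_zero, Nat.cast_one,
      one_mul] at h1
    exact nonneg_of_mul_nonneg_left h1 (Real.sqrt_pos.2 hlogN)
  refine regret_le_of_forall fun w hw => ?_
  by_cases hall : ∀ τ < T, utilityVariation ν τ ≤ switchThreshold n L μ α η R τ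
  · obtain ⟨k, rfl⟩ : ∃ k, T = k + 1 := ⟨T - 1, by omega⟩
    have h1 := IsCOFTRLStep.sum_succ_le_of_utilityVariation_le h hR hL hLη hν
      (fun t ht => (hsw t).1 fun τ hτ => hall τ (by omega)) (hall k (by omega)) hw
    have h2 : 0 ≤ c * Real.sqrt ((k + 1 : ℕ) * Real.log (Fintype.card A)) :=
      mul_nonneg hc (Real.sqrt_nonneg _)
    linarith
  · push Not at hall
    classical
    obtain ⟨hτT, hτ⟩ := Nat.find_spec hall
    have hmin : ∀ σ < Nat.find hall, utilityVariation ν σ ≤ switchThreshold n L μ α η R σ := by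
      intro σ hσ
      have h1 := Nat.find_min hall hσ
      push Not at h1
      exact h1 (hσ.trans hτT)
    set τ := Nat.find hall
    have hτ0 : τ ≠ 0 := by
      intro h0
      rw [h0] at hτ
      have h1 := h.switchThreshold_nonneg hR (n := n) (L := L) 0
      have h2 : utilityVariation ν 0 = 0 := by simp [utilityVariation]
      linarith
    -- The threshold still holds at `k = τ - 1`; the crossing is seen only after one more COFTRL
    -- round, which costs the extra 2.
    obtain ⟨k, hk⟩ : ∃ k, τ = k + 1 := ⟨τ - 1, by omega⟩
    obtain ⟨m, hm⟩ : ∃ m, T = τ + m := ⟨T - τ, by omega⟩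
    rw [hm]
    have h1 := IsCOFTRLStep.sum_succ_le_of_utilityVariation_le (T := k) h hR hL hLη hν
      (fun t ht => (hsw t).1 fun σ hσ => hmin σ (by omega)) (hmin k (by omega)) hw
    rw [← hk] at h1
    have h2 := (sum_le_regret (fun k => ν (τ + k)) (B.play fun k => ν (τ + k)) m hw).trans
      (hB _ (fun t => hν _) m)
    have h3 : ∀ t, x (τ + t) = B.play (fun k => ν (τ + k)) t := by
      intro t
      have := (hsw (τ + t)).2 τ (Nat.le_add_right _ _) hτ hmin
      rwa [Nat.add_sub_cancel_left] at this
    have h4 : 2 * (α * Real.log τ + R) / η ≤ 2 * (α * Real.log (τ + m : ℕ) + R) / η := by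
      have := h.eta_pos
      have := h.alpha_pos
      have : (0 : ℝ) < τ := Nat.cast_pos.2 (Nat.pos_of_ne_zero hτ0)
      gcongr
      omega
    have h5 : c * Real.sqrt (m * Real.log (Fintype.card A)) ≤
        c * Real.sqrt ((τ + m : ℕ) * Real.log (Fintype.card A)) := by
      gcongr
      omega
    rw [Finset.sum_range_add]
    simp only [h3]
    linarith

open Asymptotics in
/-- The logarithmic part of the regret is eventually dominated by `√(T log d)`. -/
theorem exists_forall_log_le_sqrt (α η R : ℝ) {b : ℝ} (hb : 0 < b) :
    ∃ T₀ : ℕ, ∀ T : ℕ, T₀ ≤ T → 8 + 2 * (α * Real.log T + R) / η ≤ Real.sqrt (T * b) := by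
  have h1 : (fun T : ℝ => Real.log T) =o[atTop] fun T : ℝ => T ^ (1 / 2 : ℝ) :=
    isLittleO_log_rpow_atTop (by norm_num)
  have h2 : (fun _ : ℝ => 8 + 2 * R / η) =o[atTop] fun T : ℝ => T ^ (1 / 2 : ℝ) :=
    isLittleO_const_left.2 (Or.inr
      (tendsto_norm_atTop_atTop.comp (tendsto_rpow_atTop (by norm_num))))
  have h3 := (h2.add (h1.const_mul_left (2 * α / η))).def (Real.sqrt_pos.2 hb)
  obtain ⟨T₀, hT₀⟩ := eventually_atTop.1 (tendsto_natCast_atTop_atTop.eventually h3)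
  refine ⟨T₀, fun T hT => ?_⟩
  have h4 := (le_abs_self _).trans (hT₀ T hT)
  rw [← Real.sqrt_eq_rpow, Real.norm_eq_abs, abs_of_nonneg (Real.sqrt_nonneg _), mul_comm (Real.sqrt b),
    ← Real.sqrt_mul (Nat.cast_nonneg T)] at h4
  calc _ = 8 + 2 * R / η + 2 * α / η * Real.log T := by ring
    _ ≤ _ := h4

end Threshold

/-! ### Self-play in smooth games -/

section Game

variable {n : ℕ} {A : Fin n → Type*} [∀ i, Fintype (A i)]

theorem abs_expectedUtility_le {u : (∀ j, A j) → ℝ} (hu : ∀ s, |u s| ≤ 1) {x : ∀ j, A j → ℝ}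
    (hx : ∀ j, x j ∈ stdSimplex ℝ (A j)) : |expectedUtility u x| ≤ 1 := by
  classical
  have h1 : ∑ s : (∀ j, A j), ∏ j, x j (s j) = 1 := by
    rw [← Fintype.piFinset_univ, ← Finset.prod_univ_sum]
    exact Finset.prod_eq_one fun j _ => (hx j).2
  rw [← h1]
  refine (Finset.abs_sum_le_sum_abs _ _).trans (Finset.sum_le_sum fun s _ => ?_)
  have h2 : 0 ≤ ∏ j, x j (s j) := Finset.prod_nonneg fun j _ => (hx j).1 _
  rw [abs_mul, abs_of_nonneg h2]
  exact mul_le_of_le_one_right h2 (hu s)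

variable {U : Fin n → (∀ j, A j) → ℝ}

theorem norm_utilityGradient_le (hU : BoundedUtilities U) (i : Fin n) {x : ∀ j, A j → ℝ}
    (hx : ∀ j, x j ∈ stdSimplex ℝ (A j)) : ‖utilityGradient U i x‖ ≤ 1 := by
  classical
  refine (pi_norm_le_iff_of_nonneg zero_le_one).2 fun ξ => ?_
  refine abs_expectedUtility_le (hU i) fun j => ?_
  rcases eq_or_ne j i with rfl | hj
  · rw [Function.update_self]
    convert single_mem_stdSimplex ℝ ξ
  · rw [Function.update_of_ne hj]
    exact hx j

variable {ψ : ∀ i, (A i → ℝ) → ℝ} {L γ μ α η : ℝ} {x : ∀ i, ℕ → A i → ℝ} {T : ℕ}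

/-- Smoothness in each round, then Cauchy-Schwarz over the players, which produces the factor `n`.
-/
theorem utilityVariation_observedUtility_le (hs : SmoothUtilities L U)
    (hx : ∀ i, ∀ t < T, x i t ∈ stdSimplex ℝ (A i)) (i : Fin n) :
    utilityVariation (observedUtility U x i) T ≤
      L ^ 2 * n * ∑ j, strategyVariation (x j) T := by
  simp only [strategyVariation]
  rw [Finset.sum_comm, Finset.mul_sum, utilityVariation]
  refine Finset.sum_le_sum fun t ht => ?_
  have ht := Finset.mem_range.1 ht
  have h1 := hs i (fun j => x j (t + 1)) (fun j => x j t) (fun j => hx j _ (by omega))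
    (fun j => hx j _ (by omega))
  have h2 := pow_le_pow_left₀ (norm_nonneg _) h1 2
  have h3 := sq_sum_le_card_mul_sum_sq (s := Finset.univ)
    (f := fun j => l1Norm (x j (t + 1) - x j t))
  rw [Finset.card_univ, Fintype.card_fin] at h3
  refine h2.trans ?_
  rw [mul_pow, mul_assoc]
  exact mul_le_mul_of_nonneg_left h3 (sq_nonneg L)

theorem regularizerRange_le_maxRange (ψ : ∀ i, (A i → ℝ) → ℝ) (i : Fin n) :
    regularizerRange (ψ i) ≤ maxRange ψ :=
  le_ciSup (f := fun i => regularizerRange (ψ i)) (Set.finite_range _).bddAbove i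

variable [∀ i, Nontrivial (A i)]

/-- In self-play, the total movement of the strategies is logarithmic. -/
theorem sum_strategyVariation_le (hU : BoundedUtilities U) (hL : 0 ≤ L)
    (hs : SmoothUtilities L U) (h : ∀ i, IsCOFTRLRegularizer (ψ i) γ μ α η)
    (hLη : 32 * Real.sqrt 6 * L * n * η ≤ μ) (hT : 1 ≤ T)
    (hstep : ∀ i, ∀ t < T,
      IsCOFTRLStep (ψ i) α η (optimisticRegret (observedUtility U x i) (x i) t) (x i t)) :
    ∑ j, strategyVariation (x j) T ≤
      n * (128 / μ * (3 * η + (α * Real.log T + maxRange ψ))) := by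
  have hx : ∀ i, ∀ t < T, x i t ∈ stdSimplex ℝ (A i) := fun i t ht => by
    obtain ⟨_, _, _, hx, _⟩ := hstep i t ht
    exact hx
  have hν : ∀ i, ∀ t < T, ‖observedUtility U x i t‖ ≤ 1 := fun i t ht =>
    norm_utilityGradient_le hU i fun j => hx j t ht
  set P := ∑ j, strategyVariation (x j) T with hP
  have hP0 : 0 ≤ P := Finset.sum_nonneg fun j _ => strategyVariation_nonneg _ _
  set Z := α * Real.log T + maxRange ψ with hZ
  have hT0 : (0 : ℝ) < T := Nat.cast_pos.2 hT
  have key : ∀ i, μ / 40 * strategyVariation (x i) T ≤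
      Z + 5 / 2 * η + 40 * η ^ 2 / μ * (L ^ 2 * n * P) := by
    intro i
    have hη := (h i).eta_pos
    have hμ := (h i).mu_pos
    obtain ⟨w, hw⟩ := nonempty_stdSimplex (A := A i)
    -- At this rate a regret of at least `-2T` weighs no less than `-2η`, so the negative movement
    -- term can be isolated at cost `α log T`.
    have hl : η / T ∈ Ioc 0 η :=
      ⟨div_pos hη hT0, div_le_self hη.le (by exact_mod_cast hT)⟩
    have h1 := IsCOFTRLStep.rvu (h i) hT (hν i) (hstep i) hl hw
    have h2 : -(2 * T) ≤ ∑ t ∈ Finset.range T,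
        (observedUtility U x i t ⬝ᵥ w - observedUtility U x i t ⬝ᵥ x i t) := by
      have h3 : ∑ t ∈ Finset.range T, (-2 : ℝ) ≤ ∑ t ∈ Finset.range T,
          (observedUtility U x i t ⬝ᵥ w - observedUtility U x i t ⬝ᵥ x i t) := by
        refine Finset.sum_le_sum fun t ht => ?_
        have ht := Finset.mem_range.1 ht
        exact neg_le_of_abs_le (abs_dotProduct_sub_dotProduct_le (hν i t ht) hw (hx i t ht))
      rw [Finset.sum_const, Finset.card_range, nsmul_eq_mul] at h3
      linarith
    have h4 := mul_le_mul_of_nonneg_left h2 hl.1.le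
    have h5 : η / T * -(2 * T) = -(2 * η) := by field_simp
    have h6 := mul_le_mul_of_nonneg_left (utilityVariation_observedUtility_le hs hx i)
      (by positivity : 0 ≤ 40 * η ^ 2 / μ)
    have h7 := regularizerRange_le_maxRange ψ i
    rw [div_div_cancel₀ hη.ne'] at h1
    linarith
  rcases Nat.eq_zero_or_pos n with rfl | hn
  · simp [hP]
  have i₀ : Fin n := ⟨0, hn⟩
  have hη := (h i₀).eta_pos
  have hμ := (h i₀).mu_pos
  have hZ0 : 0 ≤ Z := (h i₀).log_add_nonneg (regularizerRange_le_maxRange ψ i₀) T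
  have hsum := Finset.sum_le_sum fun i (_ : i ∈ Finset.univ) => key i
  rw [← Finset.mul_sum, Finset.sum_const, Finset.card_univ, Fintype.card_fin, nsmul_eq_mul,
    ← hP] at hsum
  have hsq := (h i₀).smoothness_sq_le hL hLη
  -- `40 / 6144 < 1 / 150`, well below the coefficient `μ / 40` on the left of `hsum`, so the
  -- movement absorbs its own feedback.
  have h1 : n * (40 * η ^ 2 / μ * (L ^ 2 * n * P)) ≤ μ / 150 * P := by
    have h2 : n * (40 * η ^ 2 / μ * (L ^ 2 * n * P)) =
        40 * (L ^ 2 * n ^ 2 * η ^ 2) / μ * P := by ring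
    rw [h2]
    refine mul_le_mul_of_nonneg_right ?_ hP0
    rw [div_le_iff₀ hμ]
    nlinarith
  have h3 : P * μ ≤ n * (128 * (3 * η + Z)) := by
    have h4 : 0 ≤ (n : ℝ) * η := by positivity
    have h5 : 0 ≤ (n : ℝ) * Z := by positivity
    have h6 : 0 ≤ μ * P := by positivity
    linarith
  have h7 : n * (128 / μ * (3 * η + Z)) = n * (128 * (3 * η + Z)) / μ := by ring
  rw [h7, le_div_iff₀ hμ]
  exact h3

/-- In self-play, the threshold of the switching rule is never exceeded. -/
theorem utilityVariation_le_switchThreshold (hU : BoundedUtilities U) (hL : 0 ≤ L)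
    (hs : SmoothUtilities L U) (h : ∀ i, IsCOFTRLRegularizer (ψ i) γ μ α η)
    (hLη : 32 * Real.sqrt 6 * L * n * η ≤ μ)
    (hstep : ∀ i, ∀ t < T,
      IsCOFTRLStep (ψ i) α η (optimisticRegret (observedUtility U x i) (x i) t) (x i t))
    (i : Fin n) :
    utilityVariation (observedUtility U x i) T ≤ switchThreshold n L μ α η (maxRange ψ) T := by
  rcases Nat.eq_zero_or_pos T with rfl | hT
  · have h1 := (h i).switchThreshold_nonneg (regularizerRange_le_maxRange ψ i) (n := n) (L := L) 0
    simpa [utilityVariation] using h1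
  have hx : ∀ i, ∀ t < T, x i t ∈ stdSimplex ℝ (A i) := fun i t ht => by
    obtain ⟨_, _, _, hx, _⟩ := hstep i t ht
    exact hx
  have h1 := utilityVariation_observedUtility_le hs hx i
  have h2 := mul_le_mul_of_nonneg_left (sum_strategyVariation_le hU hL hs h hLη hT hstep)
    (by positivity : 0 ≤ L ^ 2 * n)
  rw [switchThreshold_eq (h i).eta_pos.ne']
  calc _ ≤ _ := h1.trans h2
    _ = _ := by ring

theorem IsCOFTRL.regret_le (hU : BoundedUtilities U) (hL : 0 ≤ L)
    (hs : SmoothUtilities L U) (h : ∀ i, IsCOFTRLRegularizer (ψ i) γ μ α η)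
    (hLη : 32 * Real.sqrt 6 * L * n * η ≤ μ)
    (hplay : ∀ i, IsCOFTRL (ψ i) α η (observedUtility U x i) (x i)) (i : Fin n) (hT : 1 ≤ T) :
    regret (observedUtility U x i) (x i) T ≤ 6 + 2 * (α * Real.log T + maxRange ψ) / η := by
  refine regret_le_of_forall fun w hw => ?_
  refine IsCOFTRLStep.sum_le_of_utilityVariation_le (h i) (regularizerRange_le_maxRange ψ i) hL
    hLη hT (fun t _ => norm_utilityGradient_le hU i fun j => ?_) (fun t _ => hplay i t)
    (utilityVariation_le_switchThreshold hU hL hs h hLη (fun i t _ => hplay i t) i) hw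
  obtain ⟨_, _, _, hx, _⟩ := hplay j t
  exact hx

/-- Strong induction on the round, for all players at once: the variation tested before round `t`
involves only earlier rounds, in which everyone played COFTRL. -/
theorem IsSwitchingCOFTRL.isCOFTRL (hU : BoundedUtilities U) (hL : 0 ≤ L)
    (hs : SmoothUtilities L U) (h : ∀ i, IsCOFTRLRegularizer (ψ i) γ μ α η)
    (hLη : 32 * Real.sqrt 6 * L * n * η ≤ μ) {B : ∀ i, OnlineAlgorithm (A i)}
    (hplay : ∀ i, IsSwitchingCOFTRL (ψ i) α η (switchThreshold n L μ α η (maxRange ψ)) (B i)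
      (observedUtility U x i) (x i)) (i : Fin n) :
    IsCOFTRL (ψ i) α η (observedUtility U x i) (x i) := by
  suffices H : ∀ t i,
      IsCOFTRLStep (ψ i) α η (optimisticRegret (observedUtility U x i) (x i) t) (x i t) from
    fun t => H t i
  intro t
  induction t using Nat.strong_induction_on with
  | _ t ih =>
    intro i
    exact (hplay i t).1 fun τ hτ => utilityVariation_le_switchThreshold hU hL hs h hLη
      (fun i s hs => ih s (hs.trans_le hτ) i) i

/-- The lower bounds `κ ≥ 1`, `γ / μ ≥ 1/2` and `l ≥ 0.69` (for `l = log T`, `T ≥ 2`) let the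
product absorb `R` and the additive 6. -/
theorem regret_rate_le {α γ μ R κ m l : ℝ} (hγ : 0 < γ) (hμ : 0 < μ) (hμγ : μ ≤ 2 * γ)
    (hα : 4 * γ + μ ≤ α) (hR : R ≤ γ) (hκ : α ≤ κ * (γ + μ)) (hm : 0 ≤ m) (hl : 0.69 ≤ l) :
    6 + 2 * ((α * l + R) / μ) *
        max (80 * μ / (3 * γ)) (max (32 * Real.sqrt 2) (32 * Real.sqrt 6 * m)) ≤
      1000 * κ * max 1 m * (γ / μ) * l := by
  have hκ1 : 1 ≤ κ := by
    by_contra! hlt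
    nlinarith
  have hM1 : 1 ≤ max 1 m := le_max_left _ _
  have hmax : max (80 * μ / (3 * γ)) (max (32 * Real.sqrt 2) (32 * Real.sqrt 6 * m)) ≤
      80 * max 1 m := by
    have h2 : Real.sqrt 2 ≤ 2.5 := Real.sqrt_le_iff.2 ⟨by norm_num, by norm_num⟩
    have h6 : Real.sqrt 6 ≤ 2.5 := Real.sqrt_le_iff.2 ⟨by norm_num, by norm_num⟩
    refine max_le ?_ (max_le (by linarith) ?_)
    · rw [div_le_iff₀ (by positivity)]
      nlinarith
    · have : 32 * Real.sqrt 6 * m ≤ 80 * m := by nlinarith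
      linarith [le_max_right 1 m]
  have hαl : α * l + R ≤ 4.5 * (κ * γ * l) := by
    have h1 : α ≤ 3 * (κ * γ) := by nlinarith
    have h2 : R ≤ κ * γ := hR.trans (le_mul_of_one_le_left hγ.le hκ1)
    have h3 : 0 ≤ κ * γ := by positivity
    nlinarith
  have hX : 0.345 ≤ κ * (γ / μ) * l := by
    have h1 : 1 / 2 ≤ γ / μ := by
      rw [le_div_iff₀ hμ]
      linarith
    have h2 : 1 / 2 ≤ κ * (γ / μ) := by nlinarith
    nlinarith
  have h1 : (α * l + R) / μ ≤ 4.5 * (κ * (γ / μ) * l) := by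
    rw [div_le_iff₀ hμ]
    refine hαl.trans_eq ?_
    field_simp
  have hmax0 : 0 ≤ max (80 * μ / (3 * γ)) (max (32 * Real.sqrt 2) (32 * Real.sqrt 6 * m)) :=
    le_max_of_le_left (by positivity)
  have h2 := mul_le_mul h1 hmax hmax0 (by linarith)
  have h3 : 0.345 ≤ κ * (γ / μ) * l * max 1 m := by nlinarith
  calc _ ≤ 6 + 2 * (4.5 * (κ * (γ / μ) * l) * (80 * max 1 m)) := by linarith
    _ ≤ 1000 * (κ * (γ / μ) * l * max 1 m) := by linarith
    _ = _ := by ring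

end Game

end

theorem mainTheorem1 :
    ∃ C : ℝ, 0 < C ∧
    ∀ (n : ℕ) (A : Fin n → Type*) [∀ i, Fintype (A i)] [∀ i, Nontrivial (A i)]
      (U : Fin n → (∀ j, A j) → ℝ) (ψ : ∀ i, (A i → ℝ) → ℝ) (L γ μ α η : ℝ),
      BoundedUtilities U → 0 ≤ L → SmoothUtilities L U →
      (∀ i, ContinuousOn (ψ i) (stdSimplex ℝ (A i))) →
      (∀ i, IntrinsicallyLipschitz γ (ψ i)) →
      (∀ i, StronglyConvexL1 μ (ψ i)) →
      4 * γ + μ ≤ α →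
      0 < η → η ≤ 3 * γ / 80 → η ≤ μ / (32 * Real.sqrt 2) →
      32 * Real.sqrt 6 * L * n * η ≤ μ →
      -- regret in self-play
      (∀ x : ∀ i, ℕ → A i → ℝ,
        (∀ i, IsCOFTRL (ψ i) α η (observedUtility U x i) (x i)) →
        ∀ (i : Fin n) (T : ℕ), 1 ≤ T →
          regret (observedUtility U x i) (x i) T
              ≤ 6 + 2 * (α * Real.log T + maxRange ψ) / η ∧
          -- the largest admissible learning rate
          (1 / η = max (80 / (3 * γ))
              (max (32 * Real.sqrt 2 / μ) (32 * Real.sqrt 6 * L * n / μ)) →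
            regret (observedUtility U x i) (x i) T
              ≤ 6 + 2 * ((α * Real.log T + maxRange ψ) / μ) *
                  max (80 * μ / (3 * γ)) (max (32 * Real.sqrt 2) (32 * Real.sqrt 6 * L * n)) ∧
            ∀ κ : ℝ, α ≤ κ * (γ + μ) → 2 ≤ T →
              regret (observedUtility U x i) (x i) T
                ≤ C * κ * max 1 (L * n) * (γ / μ) * Real.log T)) ∧
      -- with the switching rule, nothing changes in self-play
      (∀ (B : ∀ i, OnlineAlgorithm (A i)) (x : ∀ i, ℕ → A i → ℝ),
        (∀ i, IsSwitchingCOFTRL (ψ i) α η (switchThreshold n L μ α η (maxRange ψ)) (B i)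
          (observedUtility U x i) (x i)) →
        ∀ i, IsCOFTRL (ψ i) α η (observedUtility U x i) (x i) ∧
          ∀ T : ℕ, utilityVariation (observedUtility U x i) T
            ≤ switchThreshold n L μ α η (maxRange ψ) T) ∧
      -- with the switching rule, regret against adversarial utilities
      (∀ (i : Fin n) (B : OnlineAlgorithm (A i)) (c : ℝ), B.HasRegretBound c →
        (∀ ν x : ℕ → A i → ℝ, (∀ t, ‖ν t‖ ≤ 1) →
          IsSwitchingCOFTRL (ψ i) α η (switchThreshold n L μ α η (maxRange ψ)) B ν x →
          ∀ T : ℕ, 1 ≤ T →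
            regret ν x T ≤ 8 + 2 * (α * Real.log T + maxRange ψ) / η
              + c * Real.sqrt (T * Real.log (Fintype.card (A i)))) ∧
        ∃ T₀ : ℕ, ∀ ν x : ℕ → A i → ℝ, (∀ t, ‖ν t‖ ≤ 1) →
          IsSwitchingCOFTRL (ψ i) α η (switchThreshold n L μ α η (maxRange ψ)) B ν x →
          ∀ T : ℕ, T₀ ≤ T →
            regret ν x T ≤ (c + 1) * Real.sqrt (T * Real.log (Fintype.card (A i)))) ∧
      -- multiplicative weights update is a valid fallback algorithm
      (∀ i, (mwu (A i)).HasRegretBound C) := by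
  refine ⟨1000, by norm_num, ?_⟩
  intro n A _ _ U ψ L γ μ α η hU hL hs hcont hlip hcvx hα hη hηγ hημ hLη
  have h : ∀ i, IsCOFTRLRegularizer (ψ i) γ μ α η := fun i =>
    ⟨hcont i, hlip i, hcvx i, hα, hη, hηγ, hημ⟩
  refine ⟨fun x hplay i T hT => ?_, fun B x hplay i => ?_, fun i B c hB => ⟨?_, ?_⟩,
    fun i => mwu_hasRegretBound (by norm_num)⟩
  · have hreg := IsCOFTRL.regret_le hU hL hs h hLη hplay i hT
    refine ⟨hreg, fun hmin => ?_⟩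
    have hγ := (h i).gamma_pos
    have hμ := (h i).mu_pos
    have hmax : max (80 * μ / (3 * γ)) (max (32 * Real.sqrt 2) (32 * Real.sqrt 6 * L * n)) =
        μ * (1 / η) := by
      rw [hmin, mul_max_of_nonneg _ _ hμ.le, mul_max_of_nonneg _ _ hμ.le]
      congr 1
      · ring
      · rw [mul_div_cancel₀ _ hμ.ne', mul_div_cancel₀ _ hμ.ne']
    have hreg' : regret (observedUtility U x i) (x i) T
        ≤ 6 + 2 * ((α * Real.log T + maxRange ψ) / μ) *
          max (80 * μ / (3 * γ)) (max (32 * Real.sqrt 2) (32 * Real.sqrt 6 * L * n)) := by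
      refine hreg.trans_eq ?_
      rw [hmax]
      field_simp
    refine ⟨hreg', fun κ hκ hT2 => hreg'.trans ?_⟩
    have : Nonempty (Fin n) := ⟨i⟩
    -- This removes the range from the rate, leaving only `γ / μ`.
    have hR : maxRange ψ ≤ γ := ciSup_le fun j => (h j).regularizerRange_le
    have hlog : 0.69 ≤ Real.log T := by
      have h1 : Real.log 2 ≤ Real.log T :=
        Real.log_le_log two_pos (by exact_mod_cast hT2)
      linarith [Real.log_two_gt_d9]
    have hfin := regret_rate_le hγ hμ (h i).mu_le_gamma hα hR hκ
      (by positivity : 0 ≤ L * (n : ℝ)) hlog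
    rwa [← mul_assoc (32 * Real.sqrt 6)] at hfin
  · have hplay' := IsSwitchingCOFTRL.isCOFTRL hU hL hs h hLη hplay
    exact ⟨hplay' i, fun T =>
      utilityVariation_le_switchThreshold hU hL hs h hLη (fun j t _ => hplay' j t) i⟩
  · intro ν x hν hsw T hT
    exact IsSwitchingCOFTRL.regret_le (h i) (regularizerRange_le_maxRange ψ i) hL hLη hB hν hsw hT
  · have hlogN : 0 < Real.log (Fintype.card (A i)) :=
      Real.log_pos (by exact_mod_cast Fintype.one_lt_card)
    obtain ⟨T₀, hT₀⟩ := exists_forall_log_le_sqrt α η (maxRange ψ) hlogN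
    refine ⟨max 1 T₀, fun ν x hν hsw T hT => ?_⟩
    have h1 := IsSwitchingCOFTRL.regret_le (h i) (regularizerRange_le_maxRange ψ i) hL hLη hB hν
      hsw (le_of_max_le_left hT)
    have h2 := hT₀ T (le_of_max_le_right hT)
    linarith
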